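/- **Setting.** Let $\mathcal S$ be a finite nonempty set of states, $\mathcal A_i$ ($i\in\mathcal S$) finite nonempty action sets, $\mathcal A=\{(i,a):i\in\mathcal S,\ a\in\mathcal A_i\}$, $A=|\mathcal A|$, and let $p_{ij}(a)$ be transition probabilities. Let $\mathbf P\in\mathbb R^{\mathcal A\times\mathcal S}$ have the rows $p_{i\cdot}(a)$, and let $\hat{\mathbf I}\in\mathbb R^{\mathcal A\times\mathcal S}$ have $(i,a)$-row $\mathbf e_i^\top$. For a randomized policy $\pi=(\pi_i)_{i}$, $\pi_i\in\Delta^{\mathcal A_i}$, put $\mathbf P^\pi(i,j)=\sum_a\pi_{i,a}p_{ij}(a)$, and let $\nu^\pi\in\Delta^{\mathcal S}$ be a stationary distribution of $\mathbf P^\pi$. Assume the process is mixing: $$t_{\rm mix}=\max_\pi\min\Big\{t\ge1:\ \max_{q\in\Delta^{\mathcal S}}\big\|((\mathbf P^{\pi})^\top)^tq-\nu^\pi\big\|_1\le\tfrac12\Big\}<\infty .$$ Let $\mathbf D=[\mathbf d_1\cdots\mathbf d_K]\in\mathbb R^{\mathcal A\times K}$, $K\ge1$, have nonnegative entries, with largest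 entry $D$, and assume that the system $$\mu\in\Delta^{\mathcal A},\qquad(\hat{\mathbf I}-\mathbf P)^\top\mu=\mathbf 0,\qquad\mathbf D^\top\mu\ge\mathbf 1\tag{1}$$ is feasible. A policy $\pi$ is a *$\delta$-approximate policy* for (1) if $\mathbf P^\pi$ has a unique stationary distribution $\nu^\pi$ and the state-action measure $\mu_{i,a}=\nu^\pi_i\pi_{i,a}$ lies in $\Delta^{\mathcal A}$ and satisfies $(\hat{\mathbf I}-\mathbf P)^\top\mu=\mathbf 0$ and $\mathbf D^\top\mu\ge(1-\delta)\mathbf 1$. Let $M=2Dt_{\rm mix}$, $\mathcal V=[-2M,2M]^{\mathcal S}$, $\Sigma=\{s\in\mathbb R^K: s\ge0,\ \sum_ks_k\le2\}$, and $$\min_{v\in\mathcal V,\,s\in\Sigma}\ \max_{\mu\in\Delta^{\mathcal A}}\ f(v,s,\mu)=\mu^\top\big[(\hat{\mathbf I}-\mathbf P)v+\mathbf Ds\big]-\mathbf 1^\top s.\tag{2}$$ An $\varepsilon$-approximate solution of (2) is a point $(v,s,\mu)\in\mathcal V\times\Sigma\times\Delta^{\mathcal A}$ with $\max_{\mu'\in\Delta^{\mathcal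 A}}f(v,s,\mu')-\min_{v'\in\mathcal V,s'\in\Sigma}f(v',s',\mu)\le\varepsilon$. **Stochastic mirror descent for (2)** with step sizes $\eta_v,\eta_s,\eta_\mu$ and $T$ iterates. Start at any $v_1\in\mathcal V$ and the uniform distributions $s_1=\frac1K\mathbf 1$, $\mu_1=\frac1A\mathbf 1$. For $t=1,\dots,T-1$ draw, independently given the past, * $(i,a)\sim\mu_t$, $j\sim p_{i\cdot}(a)$, and set $\tilde g^v=\mathbf e_i-\mathbf e_j$; * $(i,a)\sim\mu_t$, $k$ uniform on $[K]$, and set $\tilde g^s=K[d_k]_{i,a}\mathbf e_k-\mathbf 1$; * $(i,a)$ uniform on $\mathcal A$, $j\sim p_{i\cdot}(a)$, $k\sim s_t/\|s_t\|_1$, and set $\tilde g^\mu=-A\big([v_t]_i-[v_t]_j+[d_k]_{i,a}\|s_t\|_1\big)\mathbf e_{i,a}$, and update $v_{t+1}=\arg\min_{v\in\mathcal V}\langle\eta_v\tilde g^v,v\rangle+\frac12\|v-v_t\|_2^2$, $s_{t+1}=\arg\min_{s\in\Sigma}\langle\eta_s\tilde g^s,s\rangle+\mathrm{KL}(s,s_t)$,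 $\mu_{t+1}=\arg\min_{\mu\in\Delta^{\mathcal A}}\langle\eta_\mu\tilde g^\mu,\mu\rangle+\mathrm{KL}(\mu,\mu_t)$, where $\mathrm{KL}(y,x)=\sum_i\big(y_i\log(y_i/x_i)-y_i+x_i\big)$. The output is $\mu^\varepsilon=\frac1T\sum_{t=1}^T\mu_t$. **Statement.** There are absolute constants $C,c_v,c_s,c_\mu,c_T>0$ such that for every instance as above the following hold. 1. If $(v,s,\mu)$ is an $\varepsilon$-approximate solution of (2) and $\mu_{i,a}=\lambda_i\pi_{i,a}$ with $\lambda\in\Delta^{\mathcal S}$ and $\pi$ a policy, then $\pi$ is a $C\varepsilon$-approximate policy for (1). 2. Let $\varepsilon\in(0,1)$, $\eta_v=c_v\varepsilon$, $\eta_s=c_s\varepsilon K^{-1}D^{-2}$, $\eta_\mu=c_\mu\varepsilon t_{\rm mix}^{-2}D^{-2}A^{-1}$, and let $T\ge1$ be any integer with $T\ge c_T(t_{\rm mix}^2A+K)D^2\varepsilon^{-2}\log(KA)$. Then the output always has a unique decomposition $\mu^\varepsilon_{i,a}=\lambda^\varepsilon_i\pi^\varepsilon_{i,a}$ with $\lambda^\varepsilon\in\Delta^{\mathcal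 S}$ and $\pi^\varepsilon$ a policy, and $\pi^\varepsilon$ is in expectation a $C\varepsilon$-approximate policy for (1): there is a random variable $\delta\ge0$, a function of the draws, such that $\pi^\varepsilon$ is always a $\delta$-approximate policy for (1) (in particular the flow constraint $(\hat{\mathbf I}-\mathbf P)^\top\mu=\mathbf 0$ holds exactly) and $\mathbb E\,\delta\le C\varepsilon$. -/

import Mathlib

universe u v w

namespace ConMDP

noncomputable section

open scoped Matrix

/-- State-action pairs `(i, a)` with `a` an action available at state `i`. -/
abbrev Pair (S : Type u) (A : S → Type v) := (i : S) × A i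

/-- Transition probabilities of a finite Markov decision process: `p i a j` is the probability of
moving from `i` to `j` under action `a`. -/
structure MDP (S : Type u) (A : S → Type v) [Fintype S] where
  p : (i : S) → A i → S → ℝ
  p_mem : ∀ i a, p i a ∈ stdSimplex ℝ S

/-- Randomized stationary policies. -/
def policies {S : Type u} (A : S → Type v) [∀ i, Fintype (A i)] : Set ((i : S) → A i → ℝ) :=
  {π | ∀ i, π i ∈ stdSimplex ℝ (A i)}

section chain

variable {S : Type u} {A : S → Type v} [Fintype S] [DecidableEq S] [∀ i, Fintype (A i)]

/-- The state transition matrix `P^π` of a policy. -/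
def transition (M : MDP S A) (π : (i : S) → A i → ℝ) : Matrix S S ℝ :=
  Matrix.of fun i j => ∑ a, π i a * M.p i a j

/-- `ν` is a stationary distribution of `P^π`. -/
def IsStationary (M : MDP S A) (π : (i : S) → A i → ℝ) (ν : S → ℝ) : Prop :=
  ν ∈ stdSimplex ℝ S ∧ (transition M π)ᵀ *ᵥ ν = ν

/-- After `t` steps, from every initial distribution, the chain of `π` is within `ℓ₁`-distance
`1/2` of its stationary distribution. -/
def MixedAt (M : MDP S A) (π : (i : S) → A i → ℝ) (t : ℕ) : Prop :=
  ∃ ν, IsStationary M π ν ∧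
    ∀ q ∈ stdSimplex ℝ S, ∑ j, |((((transition M π)ᵀ) ^ t) *ᵥ q) j - ν j| ≤ 1 / 2

/-- The largest, over all policies, of the least `t ≥ 1` at which the chain has mixed. -/
def mixingTime (M : MDP S A) : ℕ∞ :=
  ⨆ π ∈ policies A, ⨅ t ∈ {t : ℕ | 1 ≤ t ∧ MixedAt M π t}, (t : ℕ∞)

def IsMixing (M : MDP S A) : Prop := mixingTime M ≠ ⊤

def tmix (M : MDP S A) : ℕ := (mixingTime M).toNat

end chain

section constrained

variable {S : Type u} {A : S → Type v} {K : Type w}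
  [Fintype S] [DecidableEq S] [∀ i, Fintype (A i)] [∀ i, DecidableEq (A i)]
  [Fintype K] [DecidableEq K]

/-- `μ` is an `ε`-approximate solution of the constrained problem: a state-action distribution
with `(Î - P)ᵀ μ = 0` and `Dᵀ μ ≥ (1 - ε) 1`, where `d k` is the `k`-th column of `D`.
For `ε = 0` this is feasibility. -/
def IsApproxSolution (M : MDP S A) (d : K → Pair S A → ℝ) (ε : ℝ) (μ : Pair S A → ℝ) : Prop :=
  μ ∈ stdSimplex ℝ (Pair S A) ∧
  (∀ j, ∑ x : Pair S A, μ x * ((if x.1 = j then 1 else 0) - M.p x.1 x.2 j) = 0) ∧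
  ∀ k, 1 - ε ≤ ∑ x, d k x * μ x

/-- `π` is an `ε`-approximate policy: it has a (unique) stationary distribution `ν`, and
`μ (i, a) = ν i * π i a` is an `ε`-approximate solution. -/
def IsApproxPolicy (M : MDP S A) (d : K → Pair S A → ℝ) (ε : ℝ)
    (π : (i : S) → A i → ℝ) : Prop :=
  π ∈ policies A ∧ ∃ ν, IsStationary M π ν ∧ (∀ ν', IsStationary M π ν' → ν' = ν) ∧
    IsApproxSolution M d ε (fun x => ν x.1 * π x.1 x.2)

/-- `μ (i, a) = lam i * π i a` with `lam` a distribution on states and `π` a policy. -/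
def IsDecomposition (μ : Pair S A → ℝ) (lam : S → ℝ) (π : (i : S) → A i → ℝ) : Prop :=
  lam ∈ stdSimplex ℝ S ∧ π ∈ policies A ∧ ∀ i a, μ ⟨i, a⟩ = lam i * π i a

/-- `D = max |[d_k]_{i,a}|`. -/
def maxEntry (d : K → Pair S A → ℝ) : ℝ := ⨆ kx : K × Pair S A, |d kx.1 kx.2|

/-- The box `[-2M, 2M]^S` with `M = 2 D tmix`. -/
def valueDomain (M : MDP S A) (d : K → Pair S A → ℝ) : Set (S → ℝ) :=
  {v | ∀ i, |v i| ≤ 2 * (2 * maxEntry d * tmix M)}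

/-- `{s ≥ 0 : ∑ s_k ≤ 2}`. -/
def multiplierDomain (K : Type w) [Fintype K] : Set (K → ℝ) :=
  {s | (∀ k, 0 ≤ s k) ∧ ∑ k, s k ≤ 2}

/-- `f(v, s, μ) = μᵀ((Î - P) v + D s) - 1ᵀ s`. -/
def objective (M : MDP S A) (d : K → Pair S A → ℝ)
    (v : S → ℝ) (s : K → ℝ) (μ : Pair S A → ℝ) : ℝ :=
  ∑ x : Pair S A, μ x * ((v x.1 - ∑ j, M.p x.1 x.2 j * v j) + ∑ k, d k x * s k) - ∑ k, s k

/-- Duality gap of `min_{v, s} max_μ f(v, s, μ)`. -/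
def gap (M : MDP S A) (d : K → Pair S A → ℝ)
    (v : S → ℝ) (s : K → ℝ) (μ : Pair S A → ℝ) : ℝ :=
  sSup ((fun μ' => objective M d v s μ') '' stdSimplex ℝ (Pair S A)) -
  sInf ((fun q : (S → ℝ) × (K → ℝ) => objective M d q.1 q.2 μ) ''
    (valueDomain M d ×ˢ multiplierDomain K))

/-- `(v, s, μ)` is an `ε`-approximate solution of the minimax problem. -/
def IsApproxSaddle (M : MDP S A) (d : K → Pair S A → ℝ) (ε : ℝ)
    (v : S → ℝ) (s : K → ℝ) (μ : Pair S A → ℝ) : Prop :=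
  v ∈ valueDomain M d ∧ s ∈ multiplierDomain K ∧ μ ∈ stdSimplex ℝ (Pair S A) ∧
  gap M d v s μ ≤ ε

/-- A minimizer of `F` on `C` (arbitrary if there is none). -/
def argminOn {E : Type*} [Nonempty E] (F : E → ℝ) (C : Set E) : E :=
  Classical.epsilon fun x => x ∈ C ∧ IsMinOn F C x

/-- Squared Euclidean divergence `V_x(y)`. -/
def euclidDiv {ι : Type*} [Fintype ι] (x y : ι → ℝ) : ℝ := (∑ i, (x i - y i) ^ 2) / 2

/-- Generalized Kullback-Leibler divergence `V_x(y)`; on the simplex it is the usual one. -/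
def klDivergence {ι : Type*} [Fintype ι] (x y : ι → ℝ) : ℝ :=
  ∑ i, (y i * Real.log (y i / x i) - y i + x i)

/-- Mirror step `argmin_{y ∈ C} ⟨η g, y⟩ + V_x(y)`. -/
def mirrorStep {ι : Type*} [Fintype ι] (V : (ι → ℝ) → (ι → ℝ) → ℝ) (C : Set (ι → ℝ)) (η : ℝ)
    (g x : ι → ℝ) : ι → ℝ :=
  argminOn (fun y => ∑ i, η * g i * y i + V x y) C

/-- An iterate `(v, s, μ)` of stochastic mirror descent. -/
@[ext] structure Iterate (S : Type u) (A : S → Type v) (K : Type w) where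
  v : S → ℝ
  s : K → ℝ
  μ : Pair S A → ℝ

/-- The random choices of one round: `((i,a), j)` for the `v`-gradient, `((i,a), k)` for the
`s`-gradient and `((i,a), j, k)` for the `μ`-gradient. -/
abbrev Sample (S : Type u) (A : S → Type v) (K : Type w) :=
  (Pair S A × S) × (Pair S A × K) × (Pair S A × S × K)

/-- Probability of the choices of one round at the iterate `z`: `(i,a) ∼ μ`, `j ∼ p_i(a)`;
independently `(i,a) ∼ μ`, `k` uniform; independently `(i,a)` uniform, `j ∼ p_i(a)`,
`k ∼ s / ‖s‖₁`. -/
def sampleProb (M : MDP S A) (z : Iterate S A K) : Sample S A K → ℝ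
  | ((x, j), (x', _), (x'', j'', k'')) =>
    (z.μ x * M.p x.1 x.2 j) * (z.μ x' * (1 / Fintype.card K)) *
      ((1 / Fintype.card (Pair S A)) * M.p x''.1 x''.2 j'' * (z.s k'' / ∑ k, z.s k))

/-- `e_i - e_j`, an unbiased estimator of `∇_v f`. -/
def gradV : Sample S A K → S → ℝ
  | ((x, j), _, _) => fun l => (if l = x.1 then 1 else 0) - (if l = j then 1 else 0)

/-- `K [d_k]_{i,a} e_k - 1`, an unbiased estimator of `∇_s f`. -/
def gradS (d : K → Pair S A → ℝ) : Sample S A K → K → ℝ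
  | (_, (x, k), _) => fun l => (if l = k then (Fintype.card K : ℝ) * d k x else 0) - 1

/-- `-A_tot (v_i - v_j + [d_k]_{i,a} ‖s‖₁) e_{i,a}`, an unbiased estimator of `-∇_μ f`. -/
def gradMu (d : K → Pair S A → ℝ) (z : Iterate S A K) : Sample S A K → Pair S A → ℝ
  | (_, _, (x, j, k)) => fun y => if y = x then
      -((Fintype.card (Pair S A) : ℝ) * (z.v x.1 - z.v j + d k x * ∑ l, z.s l)) else 0

/-- One round of stochastic mirror descent: descent in `(v, s)`, ascent in `μ`. -/
def smdStep (M : MDP S A) (d : K → Pair S A → ℝ) (ηv ηs ημ : ℝ)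
    (z : Iterate S A K) (ξ : Sample S A K) : Iterate S A K where
  v := mirrorStep euclidDiv (valueDomain M d) ηv (gradV ξ) z.v
  s := mirrorStep klDivergence (multiplierDomain K) ηs (gradS d ξ) z.s
  μ := mirrorStep klDivergence (stdSimplex ℝ (Pair S A)) ημ (gradMu d z ξ) z.μ

/-- The starting point: `v₁` given, `s₁` and `μ₁` uniform distributions. -/
def smdInit (v₁ : S → ℝ) : Iterate S A K where
  v := v₁
  s := fun _ => 1 / Fintype.card K
  μ := fun _ => 1 / Fintype.card (Pair S A)

/-- The iterate after `t` rounds when the random choices of the `n` rounds are `ω`. -/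
def smdIter (M : MDP S A) (d : K → Pair S A → ℝ) (ηv ηs ημ : ℝ) (v₁ : S → ℝ) {n : ℕ}
    (ω : Fin n → Sample S A K) : ℕ → Iterate S A K
  | 0 => smdInit v₁
  | t + 1 => if h : t < n then
      smdStep M d ηv ηs ημ (smdIter M d ηv ηs ημ v₁ ω t) (ω ⟨t, h⟩)
    else smdIter M d ηv ηs ημ v₁ ω t

/-- The probability that the random choices of the `n` rounds are `ω`. -/
def smdProb (M : MDP S A) (d : K → Pair S A → ℝ) (ηv ηs ημ : ℝ) (v₁ : S → ℝ) {n : ℕ}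
    (ω : Fin n → Sample S A K) : ℝ :=
  ∏ t : Fin n, sampleProb M (smdIter M d ηv ηs ημ v₁ ω t) (ω t)

/-- The `μ`-part of the output: the average over the `T = n + 1` iterates. -/
def smdOutput (M : MDP S A) (d : K → Pair S A → ℝ) (ηv ηs ημ : ℝ) (v₁ : S → ℝ) {n : ℕ}
    (ω : Fin n → Sample S A K) : Pair S A → ℝ :=
  fun x => (∑ t ∈ Finset.range (n + 1), (smdIter M d ηv ηs ημ v₁ ω t).μ x) / (n + 1)

end constrained

end

end ConMDP

set_option linter.unusedSectionVars false

/-! Rounding. For `μ = lam * π`, the measure built from the stationary distribution `ν` of `π`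
satisfies the flow constraint exactly, so only the rewards need an argument. Write `Q` for the
transposed transition matrix and `r` for column `k` averaged over `π`. Test the objective at `s =
e_k` and `v = -h`, where `h` is the centred reward collected in the first `N` steps (a truncated
solution of the Poisson equation). The flow term telescopes and the objective becomes `r ⬝ᵥ Q^N lam
- 1`, which tends to `r ⬝ᵥ ν - 1`. Mixing halves mass-zero vectors every `t ≤ tmix` steps, so `|h| ≤
4 D tmix`; this is exactly the radius of the box, so the test point is admissible for every `N` in
use. Hence a lower bound `-δ` for the objective over the primal domain makes `π` a `δ`-approximate
policy (`isApproxPolicy_of_objective_ge`). A duality gap `ε` gives such a bound with `δ = ε`,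
because a feasible `μ₀` keeps the maximum over `μ'` nonnegative (`objective_ge_of_isApproxSaddle`).

Descent. The objective is affine in `(v, s)` and linear in `μ`, so the comparison of an iterate with
`(v, s)` and `μ₀` is a sum of three linear regrets, each bounded by the three-point inequality of
its mirror step. The bound has to hold for all `(v, s)` at once, and these may depend on the draws,
so the noise does not average out against them. Auxiliary iterates in `v` and `s`, driven by the
noise alone, absorb it: noise against the comparator costs one more regret bound, and what remains
is noise against quantities known before the draw. The comparator `μ₀` is fixed and needs no
auxiliary iterate. This gives a pathwise bound free of `(v, s)` (`neg_objective_smdOutput_le`). Its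
right side is the random `δ`, and `expected_cost_le` with `expected_roundCost_le` bounds its mean.
Second moments of the estimators, not their maxima, enter there, which explains the scaling of the
step sizes. -/

namespace ConMDP

open scoped Matrix

/-! ### Mirror steps in closed form and their one-step regret. -/

section mirror

variable {ι : Type*} [Fintype ι]

lemma klDivergence_term {x y : ℝ} (hx : 0 < x) :
    y * Real.log (y / x) - y + x = x * InformationTheory.klFun (y / x) := by
  unfold InformationTheory.klFun
  field_simp
  ring

lemma klDivergence_term_nonneg {x y : ℝ} (hx : 0 < x) (hy : 0 ≤ y) :
    0 ≤ y * Real.log (y / x) - y + x := by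
  rw [klDivergence_term hx]
  exact mul_nonneg hx.le (InformationTheory.klFun_nonneg (div_nonneg hy hx.le))

lemma klDivergence_nonneg {x y : ι → ℝ} (hx : ∀ i, 0 < x i) (hy : ∀ i, 0 ≤ y i) :
    0 ≤ klDivergence x y :=
  Finset.sum_nonneg fun i _ => klDivergence_term_nonneg (hx i) (hy i)

lemma eq_of_klDivergence_eq_zero {x y : ι → ℝ} (hx : ∀ i, 0 < x i) (hy : ∀ i, 0 ≤ y i)
    (h : klDivergence x y = 0) : y = x := by
  funext i
  have h1 := (Finset.sum_eq_zero_iff_of_nonneg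
    (fun i _ => klDivergence_term_nonneg (hx i) (hy i))).1 h i (Finset.mem_univ i)
  rw [klDivergence_term (hx i)] at h1
  rcases mul_eq_zero.1 h1 with h2 | h2
  · exact absurd h2 (hx i).ne'
  · rw [InformationTheory.klFun_eq_zero_iff (div_nonneg (hy i) (hx i).le)] at h2
    rwa [div_eq_one_iff_eq (hx i).ne'] at h2

lemma euclidDiv_nonneg (x y : ι → ℝ) : 0 ≤ euclidDiv x y :=
  div_nonneg (Finset.sum_nonneg fun _ _ => sq_nonneg _) (by norm_num)

lemma eq_of_euclidDiv_eq_zero {x y : ι → ℝ} (h : euclidDiv x y = 0) : y = x := by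
  funext i
  have h0 : ∑ i, (x i - y i) ^ 2 = 0 := by
    unfold euclidDiv at h
    linarith
  have h1 := (Finset.sum_eq_zero_iff_of_nonneg (fun i _ => sq_nonneg _)).1 h0 i (Finset.mem_univ i)
  have h2 := pow_eq_zero_iff (two_ne_zero) |>.1 h1
  linarith

/-- A point that satisfies the three-point inequality is the mirror step. -/
lemma mirrorStep_eq {V : (ι → ℝ) → (ι → ℝ) → ℝ} {C : Set (ι → ℝ)} {η : ℝ} {g x m : ι → ℝ}
    (hm : m ∈ C) (hV : ∀ y ∈ C, 0 ≤ V m y) (hV0 : ∀ y ∈ C, V m y = 0 → y = m)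
    (h : ∀ y ∈ C, (∑ i, η * g i * m i + V x m) + V m y ≤ ∑ i, η * g i * y i + V x y) :
    mirrorStep V C η g x = m := by
  have hex : ∃ y, y ∈ C ∧ IsMinOn (fun y => ∑ i, η * g i * y i + V x y) C y :=
    ⟨m, hm, fun y hy => by
      have := h y hy
      have := hV y hy
      simp only [Set.mem_ofPred_eq]
      linarith⟩
  have hs := Classical.epsilon_spec hex
  have h1 : mirrorStep V C η g x ∈ C := hs.1
  have h2 := hs.2 hm
  have h3 := h _ h1
  -- The three-point inequality at the chosen minimizer, whose value is at most that of `m`, leaves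
  -- no room for a positive divergence.
  refine hV0 _ h1 (le_antisymm ?_ (hV _ h1))
  simp only [Set.mem_ofPred_eq] at h2
  change ∑ i, η * g i * mirrorStep V C η g x i + V x (mirrorStep V C η g x) ≤ _ at h2
  linarith

/-- The three-point inequality for the exponentiated gradient step, scaled by `c`. -/
lemma klDivergence_three_point {x m a y : ι → ℝ} {c : ℝ} (hx : ∀ i, 0 < x i) (hc : 0 < c)
    (hm : ∀ i, m i = c * (x i * Real.exp (-a i))) (hy : ∀ i, 0 ≤ y i) :
    ∑ i, a i * y i + klDivergence x y
      = klDivergence m y + Real.log c * ∑ i, y i - ∑ i, m i + ∑ i, x i := by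
  unfold klDivergence
  rw [Finset.mul_sum, ← Finset.sum_add_distrib, ← Finset.sum_add_distrib, ← Finset.sum_sub_distrib,
    ← Finset.sum_add_distrib]
  refine Finset.sum_congr rfl fun i _ => ?_
  rcases (hy i).eq_or_lt with h | h
  · simp [← h]
  · have hmi : 0 < m i := by
      rw [hm]
      have := hx i
      positivity
    rw [Real.log_div h.ne' (hx i).ne', Real.log_div h.ne' hmi.ne', hm i,
      Real.log_mul hc.ne' (mul_pos (hx i) (Real.exp_pos _)).ne',
      Real.log_mul (hx i).ne' (Real.exp_pos _).ne', Real.log_exp]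
    ring

lemma klDivergence_self {x : ι → ℝ} (hx : ∀ i, 0 < x i) : klDivergence x x = 0 := by
  refine Finset.sum_eq_zero fun i _ => ?_
  rw [div_self (hx i).ne']
  simp

/-- The minimizer is the normalized exponential reweighting of `x`. All points of the simplex have
the same mass, so the `log c` terms cancel. -/
lemma mirrorStep_stdSimplex [Nonempty ι] (η : ℝ) (g : ι → ℝ) {x : ι → ℝ} (hx : ∀ i, 0 < x i) :
    mirrorStep klDivergence (stdSimplex ℝ ι) η g x ∈ stdSimplex ℝ ι ∧
    (∀ i, 0 < mirrorStep klDivergence (stdSimplex ℝ ι) η g x i) ∧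
    ∀ u ∈ stdSimplex ℝ ι,
      (∑ i, η * g i * mirrorStep klDivergence (stdSimplex ℝ ι) η g x i
        + klDivergence x (mirrorStep klDivergence (stdSimplex ℝ ι) η g x))
        + klDivergence (mirrorStep klDivergence (stdSimplex ℝ ι) η g x) u
        ≤ ∑ i, η * g i * u i + klDivergence x u := by
  set Z := ∑ i, x i * Real.exp (-(η * g i)) with hZ
  have hZ0 : 0 < Z := Finset.sum_pos (fun i _ => mul_pos (hx i) (Real.exp_pos _))
    Finset.univ_nonempty
  set m : ι → ℝ := fun i => Z⁻¹ * (x i * Real.exp (-(η * g i))) with hm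
  have hmpos : ∀ i, 0 < m i := fun i =>
    mul_pos (inv_pos.2 hZ0) (mul_pos (hx i) (Real.exp_pos _))
  have hmsum : ∑ i, m i = 1 := by
    rw [hm, ← Finset.mul_sum, ← hZ, inv_mul_cancel₀ hZ0.ne']
  have hmem : m ∈ stdSimplex ℝ ι := ⟨fun i => (hmpos i).le, hmsum⟩
  have key : ∀ u ∈ stdSimplex ℝ ι, (∑ i, η * g i * m i + klDivergence x m) + klDivergence m u
      ≤ ∑ i, η * g i * u i + klDivergence x u := by
    intro u hu
    rw [klDivergence_three_point (a := fun i => η * g i) hx (inv_pos.2 hZ0) (fun i => rfl) hu.1,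
      klDivergence_three_point (a := fun i => η * g i) hx (inv_pos.2 hZ0) (fun i => rfl) hmem.1,
      klDivergence_self hmpos, hmsum, hu.2]
    linarith
  rw [mirrorStep_eq hmem (fun y hy => klDivergence_nonneg hmpos hy.1)
    (fun y hy => eq_of_klDivergence_eq_zero hmpos hy.1) key]
  exact ⟨hmem, hmpos, key⟩

lemma mirrorStep_multiplierDomain [Nonempty ι] (η : ℝ) (g : ι → ℝ) {x : ι → ℝ}
    (hx : ∀ i, 0 < x i) :
    mirrorStep klDivergence (multiplierDomain ι) η g x ∈ multiplierDomain ι ∧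
    (∀ i, 0 < mirrorStep klDivergence (multiplierDomain ι) η g x i) ∧
    ∀ u ∈ multiplierDomain ι,
      (∑ i, η * g i * mirrorStep klDivergence (multiplierDomain ι) η g x i
        + klDivergence x (mirrorStep klDivergence (multiplierDomain ι) η g x))
        + klDivergence (mirrorStep klDivergence (multiplierDomain ι) η g x) u
        ≤ ∑ i, η * g i * u i + klDivergence x u := by
  set Z := ∑ i, x i * Real.exp (-(η * g i)) with hZ
  have hZ0 : 0 < Z := Finset.sum_pos (fun i _ => mul_pos (hx i) (Real.exp_pos _))
    Finset.univ_nonempty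
  -- The exponential step is rescaled only when its mass exceeds 2. The last condition is
  -- complementary slackness: either `c = 1`, or the mass constraint is tight and `log c ≤ 0`.
  obtain ⟨c, hc, hc2, hcu⟩ : ∃ c : ℝ, 0 < c ∧ c * Z ≤ 2 ∧
      ∀ r ≤ 2, 0 ≤ Real.log c * (r - c * Z) := by
    rcases le_total Z 2 with h | h
    · exact ⟨1, one_pos, by linarith, fun r _ => by simp⟩
    · refine ⟨2 / Z, by positivity, by field_simp; rfl, fun r hr => ?_⟩
      rw [div_mul_cancel₀ _ hZ0.ne']
      exact mul_nonneg_of_nonpos_of_nonpos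
        (Real.log_nonpos (by positivity) (by rw [div_le_one hZ0]; exact h)) (by linarith)
  set m : ι → ℝ := fun i => c * (x i * Real.exp (-(η * g i))) with hm
  have hmpos : ∀ i, 0 < m i := fun i => mul_pos hc (mul_pos (hx i) (Real.exp_pos _))
  have hmsum : ∑ i, m i = c * Z := by rw [hm, ← Finset.mul_sum, ← hZ]
  have hmem : m ∈ multiplierDomain ι := ⟨fun i => (hmpos i).le, by rw [hmsum]; exact hc2⟩
  have key : ∀ u ∈ multiplierDomain ι, (∑ i, η * g i * m i + klDivergence x m) + klDivergence m u
      ≤ ∑ i, η * g i * u i + klDivergence x u := by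
    intro u hu
    rw [klDivergence_three_point (a := fun i => η * g i) hx hc (fun i => rfl) hu.1,
      klDivergence_three_point (a := fun i => η * g i) hx hc (fun i => rfl) hmem.1,
      klDivergence_self hmpos, hmsum]
    have := hcu _ hu.2
    linarith
  rw [mirrorStep_eq hmem (fun y hy => klDivergence_nonneg hmpos hy.1)
    (fun y hy => eq_of_klDivergence_eq_zero hmpos hy.1) key]
  exact ⟨hmem, hmpos, key⟩

/-- Over a box the Euclidean step separates into coordinates, and each one is a projection to an
interval. -/
lemma clip_three_point {b a x y : ℝ} (hb : 0 ≤ b) (hy : |y| ≤ b) :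
    |max (-b) (min b (x - a))| ≤ b ∧
    a * max (-b) (min b (x - a)) + (x - max (-b) (min b (x - a))) ^ 2 / 2
      + (max (-b) (min b (x - a)) - y) ^ 2 / 2 ≤ a * y + (x - y) ^ 2 / 2 := by
  rw [abs_le] at hy ⊢
  rcases le_total b (x - a) with h | h
  · rw [min_eq_left h, max_eq_right (by linarith)]
    exact ⟨⟨by linarith, le_rfl⟩, by nlinarith⟩
  · rw [min_eq_right h]
    rcases le_total (-b) (x - a) with h' | h'
    · rw [max_eq_right h']
      exact ⟨⟨h', h⟩, by nlinarith⟩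
    · rw [max_eq_left h']
      exact ⟨⟨le_rfl, by linarith⟩, by nlinarith⟩

lemma mirrorStep_box (η b : ℝ) (hb : 0 ≤ b) (g x : ι → ℝ) :
    mirrorStep euclidDiv {v : ι → ℝ | ∀ i, |v i| ≤ b} η g x ∈ {v : ι → ℝ | ∀ i, |v i| ≤ b} ∧
    ∀ u ∈ {v : ι → ℝ | ∀ i, |v i| ≤ b},
      (∑ i, η * g i * mirrorStep euclidDiv {v : ι → ℝ | ∀ i, |v i| ≤ b} η g x i
        + euclidDiv x (mirrorStep euclidDiv {v : ι → ℝ | ∀ i, |v i| ≤ b} η g x))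
        + euclidDiv (mirrorStep euclidDiv {v : ι → ℝ | ∀ i, |v i| ≤ b} η g x) u
        ≤ ∑ i, η * g i * u i + euclidDiv x u := by
  set C : Set (ι → ℝ) := {v : ι → ℝ | ∀ i, |v i| ≤ b} with hC
  set m : ι → ℝ := fun i => max (-b) (min b (x i - η * g i)) with hm
  have hmem : m ∈ C := fun i =>
    (clip_three_point (y := 0) hb (by simpa using hb)).1
  have key : ∀ u ∈ C, (∑ i, η * g i * m i + euclidDiv x m) + euclidDiv m u
      ≤ ∑ i, η * g i * u i + euclidDiv x u := by
    intro u hu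
    unfold euclidDiv
    rw [Finset.sum_div, Finset.sum_div, Finset.sum_div, ← Finset.sum_add_distrib,
      ← Finset.sum_add_distrib, ← Finset.sum_add_distrib]
    exact Finset.sum_le_sum fun i _ => (clip_three_point hb (hu i)).2
  rw [mirrorStep_eq hmem (fun y _ => euclidDiv_nonneg _ _)
    (fun y _ => eq_of_euclidDiv_eq_zero) key]
  exact ⟨hmem, key⟩

/-- Second-order term of an entropic mirror step. -/
lemma klDivergence_step_le {x m a : ι → ℝ} (hx : ∀ i, 0 < x i) (hm : ∀ i, 0 ≤ m i)
    (ha : ∀ i, |a i| ≤ 1) :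
    ∑ i, a i * (x i - m i) - klDivergence x m ≤ ∑ i, x i * a i ^ 2 := by
  unfold klDivergence
  rw [← Finset.sum_sub_distrib]
  refine Finset.sum_le_sum fun i _ => ?_
  -- Passing to the divergence from `x i * exp (-a i)`, which is nonnegative, leaves `x i * (exp (-a
  -- i) - 1 + a i)`. This is at most `x i * a i ^ 2` for `|a i| ≤ 1`.
  have h1 : m i * Real.log (m i / x i) + a i * m i
      = m i * Real.log (m i / (x i * Real.exp (-a i))) := by
    rcases (hm i).eq_or_lt with h | h
    · simp [← h]
    · rw [Real.log_div h.ne' (hx i).ne', Real.log_div h.ne' (mul_pos (hx i) (Real.exp_pos _)).ne',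
        Real.log_mul (hx i).ne' (Real.exp_pos _).ne', Real.log_exp]
      ring
  have h2 := klDivergence_term_nonneg (mul_pos (hx i) (Real.exp_pos (-a i))) (hm i)
  have h3 := (abs_le.1 (Real.abs_exp_sub_one_sub_id_le (x := -a i) (by rw [abs_neg]; exact ha i))).2
  have h4 := mul_le_mul_of_nonneg_left h3 (hx i).le
  rw [neg_sq] at h4
  nlinarith

lemma euclidDiv_step_le (x m a : ι → ℝ) :
    ∑ i, a i * (x i - m i) - euclidDiv x m ≤ (∑ i, a i ^ 2) / 2 := by
  unfold euclidDiv
  rw [Finset.sum_div, Finset.sum_div, ← Finset.sum_sub_distrib]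
  exact Finset.sum_le_sum fun i _ => by nlinarith [sq_nonneg (a i - (x i - m i))]

/-- One-step regret of a mirror step. -/
lemma regret_of_three_point {V : (ι → ℝ) → (ι → ℝ) → ℝ} {η Q : ℝ} {g x m u : ι → ℝ} (hη : 0 < η)
    (h : (∑ i, η * g i * m i + V x m) + V m u ≤ ∑ i, η * g i * u i + V x u)
    (hQ : ∑ i, (η * g i) * (x i - m i) - V x m ≤ η ^ 2 * Q) :
    ∑ i, g i * (x i - u i) ≤ (V x u - V m u) / η + η * Q := by
  have e1 : ∑ i, (η * g i) * (x i - m i) = ∑ i, η * g i * x i - ∑ i, η * g i * m i := by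
    rw [← Finset.sum_sub_distrib]
    exact Finset.sum_congr rfl fun i _ => by ring
  have e2 : η * ∑ i, g i * (x i - u i) = ∑ i, η * g i * x i - ∑ i, η * g i * u i := by
    rw [Finset.mul_sum, ← Finset.sum_sub_distrib]
    exact Finset.sum_congr rfl fun i _ => by ring
  have h3 : η * ∑ i, g i * (x i - u i) ≤ V x u - V m u + η ^ 2 * Q := by linarith
  have h4 : (V x u - V m u) / η + η * Q = (V x u - V m u + η ^ 2 * Q) / η := by
    field_simp
  rw [h4, le_div_iff₀ hη]
  linarith

lemma regret_stdSimplex [Nonempty ι] {η : ℝ} {g x u : ι → ℝ} (hη : 0 < η) (hx : ∀ i, 0 < x i)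
    (hg : ∀ i, |η * g i| ≤ 1) (hu : u ∈ stdSimplex ℝ ι) :
    ∑ i, g i * (x i - u i) ≤ (klDivergence x u
      - klDivergence (mirrorStep klDivergence (stdSimplex ℝ ι) η g x) u) / η
      + η * ∑ i, x i * g i ^ 2 := by
  obtain ⟨h1, -, h3⟩ := mirrorStep_stdSimplex η g hx
  refine regret_of_three_point hη (h3 u hu) ((klDivergence_step_le hx h1.1 hg).trans (le_of_eq ?_))
  rw [Finset.mul_sum]
  exact Finset.sum_congr rfl fun i _ => by ring

lemma regret_multiplierDomain [Nonempty ι] {η : ℝ} {g x u : ι → ℝ} (hη : 0 < η)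
    (hx : ∀ i, 0 < x i) (hg : ∀ i, |η * g i| ≤ 1) (hu : u ∈ multiplierDomain ι) :
    ∑ i, g i * (x i - u i) ≤ (klDivergence x u
      - klDivergence (mirrorStep klDivergence (multiplierDomain ι) η g x) u) / η
      + η * ∑ i, x i * g i ^ 2 := by
  obtain ⟨h1, -, h3⟩ := mirrorStep_multiplierDomain η g hx
  refine regret_of_three_point hη (h3 u hu) ((klDivergence_step_le hx h1.1 hg).trans (le_of_eq ?_))
  rw [Finset.mul_sum]
  exact Finset.sum_congr rfl fun i _ => by ring

lemma regret_box {η b : ℝ} {g x u : ι → ℝ} (hη : 0 < η) (hb : 0 ≤ b)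
    (hu : u ∈ {v : ι → ℝ | ∀ i, |v i| ≤ b}) :
    ∑ i, g i * (x i - u i) ≤ (euclidDiv x u
      - euclidDiv (mirrorStep euclidDiv {v : ι → ℝ | ∀ i, |v i| ≤ b} η g x) u) / η
      + η * ((∑ i, g i ^ 2) / 2) := by
  refine regret_of_three_point hη ((mirrorStep_box η b hb g x).2 u hu)
    ((euclidDiv_step_le _ _ _).trans (le_of_eq ?_))
  rw [← mul_div_assoc, Finset.mul_sum]
  congr 1
  exact Finset.sum_congr rfl fun i _ => by ring

end mirror

/-! ### Contraction of mass-zero vectors under a mixing chain. -/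

section contraction

variable {S : Type u} [Fintype S] [DecidableEq S]

lemma sum_mulVec_eq {Q : Matrix S S ℝ} (hQ : ∀ j, ∑ i, Q i j = 1) (z : S → ℝ) :
    ∑ i, (Q *ᵥ z) i = ∑ i, z i := by
  simp only [Matrix.mulVec, dotProduct]
  rw [Finset.sum_comm]
  refine Finset.sum_congr rfl fun j _ => ?_
  rw [← Finset.sum_mul, hQ, one_mul]

lemma sum_pow_mulVec_eq {Q : Matrix S S ℝ} (hQ : ∀ j, ∑ i, Q i j = 1) (t : ℕ) (z : S → ℝ) :
    ∑ i, ((Q ^ t) *ᵥ z) i = ∑ i, z i := by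
  induction t with
  | zero => simp
  | succ t ih => rw [pow_succ', ← Matrix.mulVec_mulVec, sum_mulVec_eq hQ, ih]

lemma sum_abs_mulVec_le {Q : Matrix S S ℝ} (hQ0 : ∀ i j, 0 ≤ Q i j) (hQ : ∀ j, ∑ i, Q i j = 1)
    (z : S → ℝ) : ∑ i, |(Q *ᵥ z) i| ≤ ∑ i, |z i| := by
  rw [← sum_mulVec_eq hQ fun i => |z i|]
  refine Finset.sum_le_sum fun i _ => ?_
  simp only [Matrix.mulVec, dotProduct]
  refine (Finset.abs_sum_le_sum_abs _ _).trans (Finset.sum_le_sum fun j _ => ?_)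
  rw [abs_mul, abs_of_nonneg (hQ0 i j)]

lemma sum_abs_pow_mulVec_le {Q : Matrix S S ℝ} (hQ0 : ∀ i j, 0 ≤ Q i j)
    (hQ : ∀ j, ∑ i, Q i j = 1) (t : ℕ) (z : S → ℝ) :
    ∑ i, |((Q ^ t) *ᵥ z) i| ≤ ∑ i, |z i| := by
  induction t with
  | zero => simp
  | succ t ih =>
    rw [pow_succ', ← Matrix.mulVec_mulVec]
    exact (sum_abs_mulVec_le hQ0 hQ _).trans ih

/-- A linear map that sends all distributions to within `1/2` of one point contracts the vectors
of total mass zero. -/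
lemma sum_abs_mulVec_le_half {R : Matrix S S ℝ} {ν : S → ℝ}
    (h : ∀ q ∈ stdSimplex ℝ S, ∑ j, |(R *ᵥ q) j - ν j| ≤ 1 / 2) {z : S → ℝ}
    (hz : ∑ i, z i = 0) : ∑ i, |(R *ᵥ z) i| ≤ (∑ i, |z i|) / 2 := by
  -- The positive and negative parts of `z` have equal mass `c`, half the `ℓ₁` norm. So `z = c (q1 -
  -- q2)` with distributions `q1`, `q2`, whose images are within `1/2 + 1/2` of each other.
  have hp : ∑ i, (z i)⁺ = (∑ i, |z i|) / 2 := by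
    have h1 : ∑ i, |z i| = 2 * ∑ i, (z i)⁺ - ∑ i, z i := by
      rw [Finset.mul_sum, ← Finset.sum_sub_distrib]
      refine Finset.sum_congr rfl fun i _ => ?_
      have := posPart_add_negPart (z i)
      have := posPart_sub_negPart (z i)
      linarith
    linarith
  have hn : ∑ i, (z i)⁻ = (∑ i, |z i|) / 2 := by
    have h1 : ∑ i, (z i)⁺ - ∑ i, (z i)⁻ = 0 := by
      rw [← Finset.sum_sub_distrib, ← hz]
      exact Finset.sum_congr rfl fun i _ => posPart_sub_negPart (z i)
    linarith
  set c := (∑ i, |z i|) / 2 with hc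
  have hc0 : 0 ≤ c := by positivity
  rcases hc0.eq_or_lt with h0 | h0
  · have hz0 : z = 0 := by
      funext i
      have h2 : ∑ i, |z i| = 0 := by linarith
      exact abs_eq_zero.1 ((Finset.sum_eq_zero_iff_of_nonneg (fun i _ => abs_nonneg _)).1 h2 i
        (Finset.mem_univ i))
    rw [← h0, hz0]
    simp
  have hq : ∀ f : S → ℝ, (∀ i, 0 ≤ f i) → ∑ i, f i = c → c⁻¹ • f ∈ stdSimplex ℝ S := by
    intro f hf hs
    refine ⟨fun i => mul_nonneg (inv_nonneg.2 hc0) (hf i), ?_⟩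
    simp only [Pi.smul_apply, smul_eq_mul]
    rw [← Finset.mul_sum, hs, inv_mul_cancel₀ h0.ne']
  have h1 := h _ (hq (fun i => (z i)⁺) (fun i => posPart_nonneg _) hp)
  have h2 := h _ (hq (fun i => (z i)⁻) (fun i => negPart_nonneg _) hn)
  set q1 := c⁻¹ • (fun i => (z i)⁺) with hq1
  set q2 := c⁻¹ • (fun i => (z i)⁻) with hq2
  have hzq : z = c • (q1 - q2) := by
    funext i
    simp only [hq1, hq2, Pi.smul_apply, Pi.sub_apply, smul_eq_mul]
    rw [← mul_sub, posPart_sub_negPart, mul_inv_cancel_left₀ h0.ne']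
  have h3 : ∀ i, |(R *ᵥ z) i| ≤ c * (|(R *ᵥ q1) i - ν i| + |(R *ᵥ q2) i - ν i|) := by
    intro i
    conv_lhs => rw [hzq]
    rw [Matrix.mulVec_smul, Matrix.mulVec_sub, Pi.smul_apply, Pi.sub_apply, smul_eq_mul, abs_mul,
      abs_of_nonneg hc0]
    refine mul_le_mul_of_nonneg_left ?_ hc0
    have := abs_sub ((R *ᵥ q1) i - ν i) ((R *ᵥ q2) i - ν i)
    rwa [sub_sub_sub_cancel_right] at this
  calc ∑ i, |(R *ᵥ z) i| ≤ ∑ i, c * (|(R *ᵥ q1) i - ν i| + |(R *ᵥ q2) i - ν i|) :=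
        Finset.sum_le_sum fun i _ => h3 i
    _ = c * (∑ i, |(R *ᵥ q1) i - ν i| + ∑ i, |(R *ᵥ q2) i - ν i|) := by
        rw [← Finset.mul_sum, Finset.sum_add_distrib]
    _ ≤ c * 1 := mul_le_mul_of_nonneg_left (by linarith) hc0
    _ = c := mul_one c

variable {Q : Matrix S S ℝ} {ν : S → ℝ} {t : ℕ}

lemma sum_abs_pow_mul_mulVec_le (hQ : ∀ j, ∑ i, Q i j = 1)
    (h : ∀ q ∈ stdSimplex ℝ S, ∑ j, |((Q ^ t) *ᵥ q) j - ν j| ≤ 1 / 2) {z : S → ℝ}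
    (hz : ∑ i, z i = 0) (m : ℕ) :
    ∑ i, |((Q ^ (t * m)) *ᵥ z) i| ≤ (1 / 2) ^ m * ∑ i, |z i| := by
  induction m with
  | zero => simp
  | succ m ih =>
    rw [mul_add_one, add_comm, pow_add, ← Matrix.mulVec_mulVec, pow_succ]
    have := sum_abs_mulVec_le_half h (z := (Q ^ (t * m)) *ᵥ z)
      (by rw [sum_pow_mulVec_eq hQ, hz])
    linarith

/-- Time is cut into blocks of length `t`: the norm does not grow inside a block and halves from one
to the next. Keeping the exact geometric partial sum lets the induction close. -/
lemma sum_range_sum_abs_pow_mulVec_le (hQ0 : ∀ i j, 0 ≤ Q i j) (hQ : ∀ j, ∑ i, Q i j = 1)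
    (h : ∀ q ∈ stdSimplex ℝ S, ∑ j, |((Q ^ t) *ᵥ q) j - ν j| ≤ 1 / 2) {z : S → ℝ}
    (hz : ∑ i, z i = 0) (m : ℕ) :
    ∑ k ∈ Finset.range (t * m), ∑ i, |((Q ^ k) *ᵥ z) i| ≤
      2 * t * (1 - (1 / 2) ^ m) * ∑ i, |z i| := by
  induction m with
  | zero => simp
  | succ m ih =>
    rw [mul_add_one, Finset.sum_range_add]
    have h1 : ∑ x ∈ Finset.range t, ∑ i, |((Q ^ (t * m + x)) *ᵥ z) i|
        ≤ ∑ x ∈ Finset.range t, (1 / 2) ^ m * ∑ i, |z i| := by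
      refine Finset.sum_le_sum fun x _ => ?_
      rw [add_comm, pow_add, ← Matrix.mulVec_mulVec]
      exact (sum_abs_pow_mulVec_le hQ0 hQ _ _).trans (sum_abs_pow_mul_mulVec_le hQ h hz m)
    rw [Finset.sum_const, Finset.card_range, nsmul_eq_mul] at h1
    rw [pow_succ]
    nlinarith

end contraction

/-! ### From a primal lower bound to an approximate policy. -/

section rounding

variable {S : Type u} {A : S → Type v} {K : Type w}
  [Fintype S] [DecidableEq S] [∀ i, Fintype (A i)]

lemma transition_transpose_nonneg (M : MDP S A) {π : (i : S) → A i → ℝ} (hπ : π ∈ policies A)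
    (i j : S) : 0 ≤ (transition M π)ᵀ i j :=
  Finset.sum_nonneg fun a _ => mul_nonneg ((hπ j).1 a) ((M.p_mem j a).1 i)

lemma sum_transition_transpose (M : MDP S A) {π : (i : S) → A i → ℝ} (hπ : π ∈ policies A)
    (j : S) : ∑ i, (transition M π)ᵀ i j = 1 := by
  simp only [transition, Matrix.transpose_apply, Matrix.of_apply]
  rw [Finset.sum_comm, ← (hπ j).2]
  refine Finset.sum_congr rfl fun a _ => ?_
  rw [← Finset.mul_sum, (M.p_mem j a).2, mul_one]

lemma exists_mixedAt_le_tmix {M : MDP S A} (hM : IsMixing M) {π : (i : S) → A i → ℝ}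
    (hπ : π ∈ policies A) : ∃ t, 1 ≤ t ∧ t ≤ tmix M ∧ MixedAt M π t := by
  have h1 : (⨅ t ∈ {t : ℕ | 1 ≤ t ∧ MixedAt M π t}, (t : ℕ∞)) ≤ mixingTime M :=
    le_iSup₂ (f := fun π (_ : π ∈ policies A) =>
      ⨅ t ∈ {t : ℕ | 1 ≤ t ∧ MixedAt M π t}, (t : ℕ∞)) π hπ
  have h2 : mixingTime M = (tmix M : ℕ∞) := (ENat.natCast_toNat hM).symm
  -- A strict bound on an infimum yields a member below it. The infimum over an empty set is `⊤`, so
  -- a policy that never mixes is excluded.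
  have h3 : (⨅ t ∈ {t : ℕ | 1 ≤ t ∧ MixedAt M π t}, (t : ℕ∞)) < ((tmix M + 1 : ℕ) : ℕ∞) := by
    refine lt_of_le_of_lt h1 ?_
    rw [h2]
    exact_mod_cast Nat.lt_succ_self _
  simp only [iInf_lt_iff] at h3
  obtain ⟨t, ht, hlt⟩ := h3
  have : t < tmix M + 1 := by exact_mod_cast hlt
  exact ⟨t, ht.1, by omega, ht.2⟩

/-- The `t`-step map fixes the difference of two stationary distributions and also halves its norm.
-/
lemma isStationary_unique {M : MDP S A} {π : (i : S) → A i → ℝ} {t : ℕ} (h : MixedAt M π t)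
    {ν₁ ν₂ : S → ℝ} (h₁ : IsStationary M π ν₁) (h₂ : IsStationary M π ν₂) : ν₁ = ν₂ := by
  obtain ⟨ν, -, hν⟩ := h
  have hp : ∀ {ν' : S → ℝ}, IsStationary M π ν' → ((transition M π)ᵀ ^ t) *ᵥ ν' = ν' := by
    intro ν' h'
    clear hν
    induction t with
    | zero => simp
    | succ t ih => rw [pow_succ, ← Matrix.mulVec_mulVec, h'.2, ih]
  have h3 := sum_abs_mulVec_le_half hν (z := ν₁ - ν₂) (by
    simp only [Pi.sub_apply]
    rw [Finset.sum_sub_distrib, h₁.1.2, h₂.1.2, sub_self])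
  rw [Matrix.mulVec_sub, hp h₁, hp h₂] at h3
  have h4 : 0 ≤ ∑ i, |(ν₁ - ν₂) i| := Finset.sum_nonneg fun _ _ => abs_nonneg _
  have h5 : ∑ i, |(ν₁ - ν₂) i| = 0 := by linarith
  funext i
  have := (Finset.sum_eq_zero_iff_of_nonneg (fun i _ => abs_nonneg _)).1 h5 i (Finset.mem_univ i)
  exact sub_eq_zero.1 (abs_eq_zero.1 this)

lemma abs_dotProduct_le {r z : S → ℝ} {D : ℝ} (hr : ∀ i, |r i| ≤ D) :
    |r ⬝ᵥ z| ≤ D * ∑ i, |z i| := by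
  unfold dotProduct
  refine (Finset.abs_sum_le_sum_abs _ _).trans ?_
  rw [Finset.mul_sum]
  refine Finset.sum_le_sum fun i _ => ?_
  rw [abs_mul]
  exact mul_le_mul_of_nonneg_right (hr i) (abs_nonneg _)

lemma sum_abs_sub_le_two {p q : S → ℝ} (hp : p ∈ stdSimplex ℝ S) (hq : q ∈ stdSimplex ℝ S) :
    ∑ i, |(p - q) i| ≤ 2 := by
  calc ∑ i, |(p - q) i| ≤ ∑ i, (p i + q i) := Finset.sum_le_sum fun i _ => by
        rw [Pi.sub_apply, abs_le]
        have := hp.1 i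
        have := hq.1 i
        constructor <;> linarith
    _ = 2 := by rw [Finset.sum_add_distrib, hp.2, hq.2]; norm_num

variable [Fintype K] [∀ i, DecidableEq (A i)]

/-- Averaging over actions moves the objective from state-action pairs to the chain on states, where
the mixing estimates apply. -/
lemma objective_decomposition (M : MDP S A) (d : K → Pair S A → ℝ) {π : (i : S) → A i → ℝ}
    (hπ : π ∈ policies A) (lam v : S → ℝ) (s : K → ℝ) :
    objective M d v s (fun x => lam x.1 * π x.1 x.2)
      = v ⬝ᵥ lam - v ⬝ᵥ ((transition M π)ᵀ *ᵥ lam)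
        + ∑ k, s k * ((fun i => ∑ a, π i a * d k ⟨i, a⟩) ⬝ᵥ lam) - ∑ k, s k := by
  unfold objective
  congr 1
  simp only [mul_add, mul_sub, Finset.sum_add_distrib, Finset.sum_sub_distrib]
  congr 1
  · congr 1
    · rw [Fintype.sum_sigma]
      unfold dotProduct
      refine Finset.sum_congr rfl fun i _ => ?_
      dsimp only
      rw [← Finset.sum_mul, ← Finset.mul_sum, (hπ i).2]
      ring
    · rw [Fintype.sum_sigma]
      simp only [dotProduct, Matrix.mulVec, transition, Matrix.transpose_apply, Matrix.of_apply,
        Finset.mul_sum, Finset.sum_mul]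
      rw [Finset.sum_comm (s := Finset.univ (α := S)) (t := Finset.univ (α := S))]
      refine Finset.sum_congr rfl fun i _ => ?_
      rw [Finset.sum_comm]
      exact Finset.sum_congr rfl fun j _ => Finset.sum_congr rfl fun a _ => by ring
  · simp only [dotProduct, Finset.mul_sum, Finset.sum_mul]
    rw [Finset.sum_comm]
    refine Finset.sum_congr rfl fun k _ => ?_
    rw [Fintype.sum_sigma]
    exact Finset.sum_congr rfl fun i _ => Finset.sum_congr rfl fun a _ => by ring

lemma abs_le_maxEntry (d : K → Pair S A → ℝ) (k : K) (x : Pair S A) : |d k x| ≤ maxEntry d :=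
  le_ciSup (f := fun kx : K × Pair S A => |d kx.1 kx.2|) (Set.finite_range _).bddAbove (k, x)

/-- Rounding: if the objective is at least `-δ` on the whole primal domain at `μ = lam * π`, then
`π` is a `δ`-approximate policy. -/
lemma isApproxPolicy_of_objective_ge [DecidableEq K] {M : MDP S A} {d : K → Pair S A → ℝ}
    (hM : IsMixing M) {μ : Pair S A → ℝ} {lam : S → ℝ} {π : (i : S) → A i → ℝ}
    (hdec : IsDecomposition μ lam π) {δ : ℝ}
    (hδ : ∀ v ∈ valueDomain M d, ∀ s ∈ multiplierDomain K, -δ ≤ objective M d v s μ) :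
    IsApproxPolicy M d δ π := by
  obtain ⟨hlam, hπ, hμ⟩ := hdec
  have hμ' : μ = fun x => lam x.1 * π x.1 x.2 := funext fun x => hμ x.1 x.2
  obtain ⟨t, ht1, htm, hmix⟩ := exists_mixedAt_le_tmix hM hπ
  obtain ⟨ν, hν, hc⟩ := id hmix
  refine ⟨hπ, ν, hν, fun ν' h' => isStationary_unique hmix h' hν, ?_, ?_, ?_⟩
  · refine ⟨fun x => mul_nonneg (hν.1.1 _) ((hπ _).1 _), ?_⟩
    rw [Fintype.sum_sigma, ← hν.1.2]
    refine Finset.sum_congr rfl fun i _ => ?_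
    dsimp only
    rw [← Finset.mul_sum, (hπ i).2, mul_one]
  · intro j
    have h1 := congrFun hν.2 j
    simp only [Matrix.mulVec, dotProduct, transition, Matrix.transpose_apply, Matrix.of_apply] at h1
    simp only [mul_sub, Finset.sum_sub_distrib]
    rw [sub_eq_zero, Fintype.sum_sigma, Fintype.sum_sigma]
    dsimp only
    have h2 : ∀ i, ∑ a, ν i * π i a * (if i = j then (1 : ℝ) else 0) = if i = j then ν j else 0 := by
      intro i
      split_ifs with h
      · subst h
        simp only [mul_one]
        rw [← Finset.mul_sum, (hπ i).2, mul_one]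
      · simp
    simp only [h2]
    rw [Finset.sum_ite_eq' Finset.univ j (fun _ => ν j), if_pos (Finset.mem_univ j)]
    conv_lhs => rw [← h1]
    refine Finset.sum_congr rfl fun i _ => ?_
    rw [Finset.sum_mul]
    exact Finset.sum_congr rfl fun a _ => by ring
  · intro k
    set D := maxEntry d with hD
    have hD0 : 0 ≤ D := Real.iSup_nonneg fun _ => abs_nonneg _
    set Q := (transition M π)ᵀ with hQdef
    have hQ0 := transition_transpose_nonneg M hπ
    have hQ1 := sum_transition_transpose M hπ
    set r : S → ℝ := fun i => ∑ a, π i a * d k ⟨i, a⟩ with hr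
    have hrD : ∀ i, |r i| ≤ D := by
      intro i
      calc |r i| ≤ ∑ a, |π i a * d k ⟨i, a⟩| := Finset.abs_sum_le_sum_abs _ _
        _ ≤ ∑ a, π i a * D := Finset.sum_le_sum fun a _ => by
            rw [abs_mul, abs_of_nonneg ((hπ i).1 a)]
            exact mul_le_mul_of_nonneg_left (abs_le_maxEntry d k _) ((hπ i).1 a)
        _ = D := by rw [← Finset.sum_mul, (hπ i).2, one_mul]
    have hgoal : ∑ x : Pair S A, d k x * (ν x.1 * π x.1 x.2) = r ⬝ᵥ ν := by
      rw [Fintype.sum_sigma]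
      simp only [hr, dotProduct, Finset.sum_mul]
      exact Finset.sum_congr rfl fun i _ => Finset.sum_congr rfl fun a _ => by ring
    rw [hgoal]
    have hbound : ∀ m : ℕ, 1 - δ ≤ r ⬝ᵥ ν + D * ((1 / 2) ^ m * 2) := by
      intro m
      -- `H z` is the reward collected in `t * m` steps from `z`. Subtracting `ν` makes `h` bounded
      -- uniformly in `m`.
      set H : (S → ℝ) → ℝ := fun z => ∑ n ∈ Finset.range (t * m), r ⬝ᵥ ((Q ^ n) *ᵥ z) with hH
      set h : S → ℝ := fun i => H (Pi.single i 1 - ν) with hh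
      have hHsub : ∀ y z, H (y - z) = H y - H z := fun y z => by
        simp only [hH, Matrix.mulVec_sub, dotProduct_sub, Finset.sum_sub_distrib]
      have hHdot : ∀ z : S → ℝ, (fun i => H (Pi.single i 1)) ⬝ᵥ z = H z := by
        intro z
        simp only [hH, dotProduct, Finset.sum_mul]
        rw [Finset.sum_comm]
        refine Finset.sum_congr rfl fun n _ => ?_
        rw [Finset.sum_comm]
        refine Finset.sum_congr rfl fun i _ => ?_
        rw [Matrix.mulVec, dotProduct, Finset.mul_sum]
        exact Finset.sum_congr rfl fun j _ => by simp; ring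
      have hhdot : ∀ z : S → ℝ, ∑ i, z i = 1 → h ⬝ᵥ z = H z - H ν := by
        intro z hz
        have : h = (fun i => H (Pi.single i 1)) - fun _ => H ν := by
          funext i
          simp only [hh, hHsub, Pi.sub_apply]
        rw [this, sub_dotProduct, hHdot]
        simp only [dotProduct]
        rw [← Finset.mul_sum, hz, mul_one]
      -- The norm of `e_i - ν` is at most 2 and summing over time costs `2 * t`, so the total is `4
      -- D tmix`, the radius of `valueDomain`.
      have hhb : ∀ i, |h i| ≤ 2 * (2 * D * tmix M) := by
        intro i
        have hsi : (Pi.single i 1 : S → ℝ) ∈ stdSimplex ℝ S := single_mem_stdSimplex ℝ i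
        have hz0 : ∑ j, ((Pi.single i 1 : S → ℝ) - ν) j = 0 := by
          simp only [Pi.sub_apply]
          rw [Finset.sum_sub_distrib, hsi.2, hν.1.2, sub_self]
        have h2 := sum_range_sum_abs_pow_mulVec_le hQ0 hQ1 hc hz0 m
        have h3 := sum_abs_sub_le_two hsi hν.1
        have h4 : |h i| ≤ D * ∑ n ∈ Finset.range (t * m),
            ∑ j, |((Q ^ n) *ᵥ ((Pi.single i 1 : S → ℝ) - ν)) j| := by
          simp only [hh, hH]
          refine (Finset.abs_sum_le_sum_abs _ _).trans ?_
          rw [Finset.mul_sum]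
          exact Finset.sum_le_sum fun n _ => abs_dotProduct_le hrD
        have htr : (t : ℝ) ≤ tmix M := by exact_mod_cast htm
        have hpow : (0 : ℝ) ≤ (1 / 2) ^ m := by positivity
        have hpow1 : ((1 : ℝ) / 2) ^ m ≤ 1 := pow_le_one₀ (by norm_num) (by norm_num)
        have h5 : 2 * (t : ℝ) * (1 - (1 / 2) ^ m) *
            ∑ j, |((Pi.single i 1 : S → ℝ) - ν) j| ≤ 2 * tmix M * 1 * 2 := by
          gcongr
          · linarith
        calc |h i| ≤ D * (2 * tmix M * 1 * 2) :=
              h4.trans (mul_le_mul_of_nonneg_left (h2.trans h5) hD0)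
          _ = 2 * (2 * D * tmix M) := by ring
      have hs : (Pi.single k 1 : K → ℝ) ∈ multiplierDomain K := by
        have := single_mem_stdSimplex ℝ k
        exact ⟨this.1, by rw [this.2]; norm_num⟩
      -- Both `lam` and `Q *ᵥ lam` have mass one, so the centring constant `H ν` cancels and `htel`
      -- turns this into a bound on `r ⬝ᵥ Q ^ (t * m) *ᵥ lam`.
      have hobj := hδ (-h) (fun i => by rw [Pi.neg_apply, abs_neg]; exact hhb i) _ hs
      have hs1 : ∑ l, (Pi.single k 1 : K → ℝ) l = 1 := (single_mem_stdSimplex ℝ k).2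
      rw [hμ', objective_decomposition M d hπ, hs1, Finset.sum_eq_single k
        (fun b _ hb => by rw [Pi.single_eq_of_ne hb, zero_mul])
        (fun hk => absurd (Finset.mem_univ k) hk), Pi.single_eq_same, one_mul,
        neg_dotProduct, neg_dotProduct, hhdot lam hlam.2,
        hhdot _ (by rw [sum_mulVec_eq hQ1, hlam.2])] at hobj
      have htel : H lam - H (Q *ᵥ lam) = r ⬝ᵥ lam - r ⬝ᵥ ((Q ^ (t * m)) *ᵥ lam) := by
        simp only [hH]
        rw [← Finset.sum_sub_distrib]
        have := Finset.sum_range_sub' (fun n => r ⬝ᵥ ((Q ^ n) *ᵥ lam)) (t * m)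
        simp only [pow_zero, Matrix.one_mulVec] at this
        rw [← this]
        exact Finset.sum_congr rfl fun n _ => by rw [Matrix.mulVec_mulVec, ← pow_succ]
      have hlim : r ⬝ᵥ ((Q ^ (t * m)) *ᵥ lam) - r ⬝ᵥ ν ≤ D * ((1 / 2) ^ m * 2) := by
        have hz0 : ∑ j, (lam - ν) j = 0 := by
          simp only [Pi.sub_apply]
          rw [Finset.sum_sub_distrib, hlam.2, hν.1.2, sub_self]
        have hpν : (Q ^ (t * m)) *ᵥ ν = ν := by
          generalize t * m = N
          induction N with
          | zero => simp
          | succ N ih => rw [pow_succ, ← Matrix.mulVec_mulVec, hν.2, ih]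
        calc r ⬝ᵥ ((Q ^ (t * m)) *ᵥ lam) - r ⬝ᵥ ν
            = r ⬝ᵥ ((Q ^ (t * m)) *ᵥ (lam - ν)) := by
              rw [Matrix.mulVec_sub, dotProduct_sub, hpν]
          _ ≤ D * ∑ i, |((Q ^ (t * m)) *ᵥ (lam - ν)) i| :=
              (le_abs_self _).trans (abs_dotProduct_le hrD)
          _ ≤ D * ((1 / 2) ^ m * 2) := by
              refine mul_le_mul_of_nonneg_left ?_ hD0
              refine (sum_abs_pow_mul_mulVec_le hQ1 hc hz0 m).trans ?_
              gcongr
              exact sum_abs_sub_le_two hlam hν.1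
      linarith
    have hlim : Filter.Tendsto (fun m : ℕ => r ⬝ᵥ ν + D * ((1 / 2) ^ m * 2)) Filter.atTop
        (nhds (r ⬝ᵥ ν + D * (0 * 2))) :=
      (((tendsto_pow_atTop_nhds_zero_of_lt_one (by norm_num) (by norm_num)).mul_const 2).const_mul
        D).const_add _
    have := ge_of_tendsto' hlim hbound
    simpa using this

end rounding

/-! ### A priori bounds on the data and the objective. -/

section bounds

variable {S : Type u} {A : S → Type v} {K : Type w}
  [Fintype S] [DecidableEq S] [∀ i, Fintype (A i)] [∀ i, DecidableEq (A i)] [Fintype K]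
  {M : MDP S A} {d : K → Pair S A → ℝ}

lemma maxEntry_nonneg (d : K → Pair S A → ℝ) : 0 ≤ maxEntry d :=
  Real.iSup_nonneg fun _ => abs_nonneg _

lemma sum_mul_le_maxEntry {μ : Pair S A → ℝ} (hμ : μ ∈ stdSimplex ℝ (Pair S A)) (k : K) :
    ∑ x, d k x * μ x ≤ maxEntry d := by
  calc ∑ x, d k x * μ x ≤ ∑ x, maxEntry d * μ x := Finset.sum_le_sum fun x _ =>
        mul_le_mul_of_nonneg_right ((le_abs_self _).trans (abs_le_maxEntry d k x)) (hμ.1 x)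
    _ = maxEntry d := by rw [← Finset.mul_sum, hμ.2, mul_one]

/-- A feasible `μ` averages some column to at least 1, and an average does not exceed the largest
entry. -/
lemma one_le_maxEntry [Nonempty K] (h : ∃ μ, IsApproxSolution M d 0 μ) : 1 ≤ maxEntry d := by
  obtain ⟨μ, hμ, -, h⟩ := h
  obtain ⟨k⟩ := ‹Nonempty K›
  have h1 := h k
  have h2 := sum_mul_le_maxEntry (d := d) hμ k
  linarith

lemma one_le_tmix [∀ i, Nonempty (A i)] (hM : IsMixing M) : 1 ≤ tmix M := by
  have hne : ∀ i, ∃ q : A i → ℝ, q ∈ stdSimplex ℝ (A i) := fun i =>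
    ⟨Pi.single (Classical.arbitrary _) 1, single_mem_stdSimplex ℝ _⟩
  choose π hπ using hne
  obtain ⟨t, h1, h2, -⟩ := exists_mixedAt_le_tmix (π := π) hM hπ
  omega

lemma sum_mul_mean_eq (μ : Pair S A → ℝ) (v : S → ℝ) :
    ∑ j, v j * ∑ x : Pair S A, μ x * ((if x.1 = j then 1 else 0) - M.p x.1 x.2 j)
      = ∑ x : Pair S A, μ x * (v x.1 - ∑ j, M.p x.1 x.2 j * v j) := by
  simp only [Finset.mul_sum]
  rw [Finset.sum_comm]
  refine Finset.sum_congr rfl fun x _ => ?_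
  have : ∀ j, v j * (μ x * ((if x.1 = j then 1 else 0) - M.p x.1 x.2 j))
      = (if x.1 = j then μ x * v j else 0) - μ x * (M.p x.1 x.2 j * v j) := by
    intro j
    split_ifs <;> ring
  simp only [this]
  rw [Finset.sum_sub_distrib, Finset.sum_ite_eq, if_pos (Finset.mem_univ _), ← Finset.mul_sum]
  ring

lemma objective_eq (v : S → ℝ) (s : K → ℝ) (μ : Pair S A → ℝ) :
    objective M d v s μ
      = ∑ j, v j * (∑ x : Pair S A, μ x * ((if x.1 = j then 1 else 0) - M.p x.1 x.2 j))
        + ∑ k, s k * (∑ x, d k x * μ x - 1) := by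
  unfold objective
  rw [sum_mul_mean_eq]
  simp only [mul_add, mul_sub, Finset.sum_add_distrib, Finset.sum_sub_distrib, mul_one]
  rw [add_sub_assoc]
  congr 2
  simp only [Finset.mul_sum]
  rw [Finset.sum_comm]
  exact Finset.sum_congr rfl fun k _ => Finset.sum_congr rfl fun x _ => by ring

lemma objective_nonneg_of_feasible {μ : Pair S A → ℝ} (h : IsApproxSolution M d 0 μ)
    (v : S → ℝ) {s : K → ℝ} (hs : ∀ k, 0 ≤ s k) : 0 ≤ objective M d v s μ := by
  rw [objective_eq]
  refine add_nonneg (Finset.sum_nonneg fun j _ => ?_) (Finset.sum_nonneg fun k _ => ?_)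
  · rw [h.2.1 j, mul_zero]
  · exact mul_nonneg (hs k) (by linarith [h.2.2 k])

lemma abs_sub_le_of_mem_valueDomain {v : S → ℝ} (hv : v ∈ valueDomain M d) (i j : S) :
    |v i - v j| ≤ 8 * (maxEntry d * tmix M) := by
  have h1 := abs_le.1 (hv i)
  have h2 := abs_le.1 (hv j)
  rw [abs_le]
  constructor <;> linarith [h1.1, h1.2, h2.1, h2.2]

/-- The bound makes the `sSup` and `sInf` in `gap` meaningful, and later covers the last iterate,
which no draw follows. The constant is 8 from `v`, 2 from the rewards and 2 from `∑ k, s k`. -/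
lemma abs_objective_le {v : S → ℝ} {s : K → ℝ} {μ : Pair S A → ℝ} (hD : 1 ≤ maxEntry d)
    (ht : 1 ≤ tmix M) (hv : v ∈ valueDomain M d) (hs : s ∈ multiplierDomain K)
    (hμ : μ ∈ stdSimplex ℝ (Pair S A)) :
    |objective M d v s μ| ≤ 12 * (maxEntry d * tmix M) := by
  have ht' : (1 : ℝ) ≤ tmix M := by exact_mod_cast ht
  have hDt : maxEntry d ≤ maxEntry d * tmix M := le_mul_of_one_le_right (by linarith) ht'
  have hs0 : 0 ≤ ∑ k, s k := Finset.sum_nonneg fun k _ => hs.1 k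
  have h1 : ∀ x : Pair S A, |(v x.1 - ∑ j, M.p x.1 x.2 j * v j) + ∑ k, d k x * s k|
      ≤ 10 * (maxEntry d * tmix M) := by
    intro x
    have e : v x.1 - ∑ j, M.p x.1 x.2 j * v j = ∑ j, M.p x.1 x.2 j * (v x.1 - v j) := by
      simp only [mul_sub, Finset.sum_sub_distrib]
      rw [← Finset.sum_mul, (M.p_mem _ _).2, one_mul]
    have h2 : |v x.1 - ∑ j, M.p x.1 x.2 j * v j| ≤ 8 * (maxEntry d * tmix M) := by
      rw [e]
      calc |∑ j, M.p x.1 x.2 j * (v x.1 - v j)| ≤ ∑ j, |M.p x.1 x.2 j * (v x.1 - v j)| :=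
            Finset.abs_sum_le_sum_abs _ _
        _ ≤ ∑ j, M.p x.1 x.2 j * (8 * (maxEntry d * tmix M)) := Finset.sum_le_sum fun j _ => by
            rw [abs_mul, abs_of_nonneg ((M.p_mem _ _).1 j)]
            exact mul_le_mul_of_nonneg_left (abs_sub_le_of_mem_valueDomain hv _ _)
              ((M.p_mem _ _).1 j)
        _ = 8 * (maxEntry d * tmix M) := by rw [← Finset.sum_mul, (M.p_mem _ _).2, one_mul]
    have h3 : |∑ k, d k x * s k| ≤ 2 * maxEntry d := by
      calc |∑ k, d k x * s k| ≤ ∑ k, |d k x * s k| := Finset.abs_sum_le_sum_abs _ _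
        _ ≤ ∑ k, maxEntry d * s k := Finset.sum_le_sum fun k _ => by
            rw [abs_mul, abs_of_nonneg (hs.1 k)]
            exact mul_le_mul_of_nonneg_right (abs_le_maxEntry d k x) (hs.1 k)
        _ = maxEntry d * ∑ k, s k := by rw [Finset.mul_sum]
        _ ≤ 2 * maxEntry d := by
            have := mul_le_mul_of_nonneg_left hs.2 (maxEntry_nonneg d)
            linarith
    refine (abs_add_le _ _).trans ?_
    linarith
  have h4 : |∑ x : Pair S A, μ x * ((v x.1 - ∑ j, M.p x.1 x.2 j * v j) + ∑ k, d k x * s k)|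
      ≤ 10 * (maxEntry d * tmix M) := by
    calc _ ≤ ∑ x : Pair S A, |μ x * ((v x.1 - ∑ j, M.p x.1 x.2 j * v j) + ∑ k, d k x * s k)| :=
          Finset.abs_sum_le_sum_abs _ _
      _ ≤ ∑ x : Pair S A, μ x * (10 * (maxEntry d * tmix M)) := Finset.sum_le_sum fun x _ => by
          rw [abs_mul, abs_of_nonneg (hμ.1 x)]
          exact mul_le_mul_of_nonneg_left (h1 x) (hμ.1 x)
      _ = 10 * (maxEntry d * tmix M) := by rw [← Finset.sum_mul, hμ.2, one_mul]
  unfold objective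
  refine (abs_sub _ _).trans ?_
  rw [abs_of_nonneg hs0]
  linarith [hs.2]

/-- Only the primal part of the duality gap matters for rounding. -/
lemma objective_ge_of_isApproxSaddle {ε : ℝ} {v : S → ℝ} {s : K → ℝ} {μ : Pair S A → ℝ}
    (hD : 1 ≤ maxEntry d) (ht : 1 ≤ tmix M) (hfeas : ∃ μ, IsApproxSolution M d 0 μ)
    (h : IsApproxSaddle M d ε v s μ) :
    0 ≤ ε ∧ ∀ v' ∈ valueDomain M d, ∀ s' ∈ multiplierDomain K, -ε ≤ objective M d v' s' μ := by
  obtain ⟨hv, hs, hμ, hgap⟩ := h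
  obtain ⟨μ₀, hμ₀⟩ := hfeas
  unfold gap at hgap
  have hsup : ∀ μ' ∈ stdSimplex ℝ (Pair S A), objective M d v s μ' ≤
      sSup ((fun μ' => objective M d v s μ') '' stdSimplex ℝ (Pair S A)) := fun μ' hμ' =>
    le_csSup ⟨12 * (maxEntry d * tmix M), by
      rintro _ ⟨μ', hμ', rfl⟩
      exact (le_abs_self _).trans (abs_objective_le hD ht hv hs hμ')⟩ ⟨μ', hμ', rfl⟩
  have hinf : ∀ v' ∈ valueDomain M d, ∀ s' ∈ multiplierDomain K,
      sInf ((fun q : (S → ℝ) × (K → ℝ) => objective M d q.1 q.2 μ) ''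
        (valueDomain M d ×ˢ multiplierDomain K)) ≤ objective M d v' s' μ := fun v' hv' s' hs' =>
    csInf_le ⟨-(12 * (maxEntry d * tmix M)), by
      rintro _ ⟨q, hq, rfl⟩
      exact (abs_le.1 (abs_objective_le hD ht hq.1 hq.2 hμ)).1⟩ ⟨(v', s'), ⟨hv', hs'⟩, rfl⟩
  have h0 := objective_nonneg_of_feasible hμ₀ v hs.1
  have h1 := hsup μ₀ hμ₀.1
  refine ⟨?_, fun v' hv' s' hs' => ?_⟩
  -- Comparing the point with itself shows that the gap is nonnegative; this later allows `ε` to be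
  -- enlarged to a multiple of itself.
  · have := hsup μ hμ
    have := hinf v hv s hs
    linarith
  · have := hinf v' hv' s' hs'
    linarith

end bounds

/-! ### Expected cost of a controlled process, and moments of unbiased noise. -/

section process

variable {W Ω : Type*} [Fintype Ω]

/-- The trajectory of a controlled process driven by `n` draws. -/
def trajectory (step : W → Ω → W) (w : W) {n : ℕ} (ω : Fin n → Ω) : ℕ → W
  | 0 => w
  | t + 1 => if h : t < n then step (trajectory step w ω t) (ω ⟨t, h⟩)
    else trajectory step w ω t

/-- After its first draw the process is the same process restarted at the new state; this permits
induction on the number of draws with a varying start. -/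
lemma trajectory_cons (step : W → Ω → W) (w : W) {n : ℕ} (ξ : Ω) (ω : Fin n → Ω) (t : ℕ) :
    trajectory step w (Fin.cons ξ ω : Fin (n + 1) → Ω) (t + 1)
      = trajectory step (step w ξ) ω t := by
  induction t with
  | zero => simp [trajectory]
  | succ t ih =>
    rw [trajectory, ih]
    by_cases h : t < n
    · rw [dif_pos (by omega), trajectory, dif_pos h]
      rfl
    · rw [dif_neg (by omega), trajectory, dif_neg h]

lemma trajectory_invariant {step : W → Ω → W} {Inv : W → Prop}
    (hstep : ∀ w, Inv w → ∀ ξ, Inv (step w ξ)) {w : W} (hw : Inv w) {n : ℕ} (ω : Fin n → Ω)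
    (t : ℕ) : Inv (trajectory step w ω t) := by
  induction t with
  | zero => exact hw
  | succ t ih =>
    rw [trajectory]
    split_ifs
    · exact hstep _ ih _
    · exact ih

/-- If the draws have conditional expected cost at most `B` at every state, then the total expected
cost of `n` draws is at most `n * B`. -/
lemma expected_cost_le {step : W → Ω → W} {prob Y : W → Ω → ℝ} {Inv : W → Prop} {B : ℝ}
    (hstep : ∀ w, Inv w → ∀ ξ, Inv (step w ξ))
    (hprob : ∀ w, Inv w → ∀ ξ, 0 ≤ prob w ξ) (hsum : ∀ w, Inv w → ∑ ξ, prob w ξ = 1)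
    (hY : ∀ w, Inv w → ∑ ξ, prob w ξ * Y w ξ ≤ B) (n : ℕ) (w : W) (hw : Inv w) :
    ∑ ω : Fin n → Ω, (∏ t : Fin n, prob (trajectory step w ω t) (ω t)) = 1 ∧
    ∑ ω : Fin n → Ω, (∏ t : Fin n, prob (trajectory step w ω t) (ω t)) *
      ∑ t : Fin n, Y (trajectory step w ω t) (ω t) ≤ n * B := by
  induction n generalizing w with
  | zero => simp
  | succ n ih =>
    -- Conditioning on the first draw splits both the law and the cost. Total mass one is part of
    -- the induction because the cost of the first draw is summed over all later draws.
    have hp : ∀ (ξ : Ω) (ω : Fin n → Ω),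
        ∏ t : Fin (n + 1), prob (trajectory step w (Fin.cons ξ ω : Fin (n + 1) → Ω) t)
          ((Fin.cons ξ ω : Fin (n + 1) → Ω) t)
        = prob w ξ * ∏ t : Fin n, prob (trajectory step (step w ξ) ω t) (ω t) := by
      intro ξ ω
      rw [Fin.prod_univ_succ]
      simp only [Fin.val_succ, trajectory_cons, Fin.cons_succ, Fin.cons_zero, Fin.val_zero]
      rfl
    have hs : ∀ (ξ : Ω) (ω : Fin n → Ω),
        ∑ t : Fin (n + 1), Y (trajectory step w (Fin.cons ξ ω : Fin (n + 1) → Ω) t)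
          ((Fin.cons ξ ω : Fin (n + 1) → Ω) t)
        = Y w ξ + ∑ t : Fin n, Y (trajectory step (step w ξ) ω t) (ω t) := by
      intro ξ ω
      rw [Fin.sum_univ_succ]
      simp only [Fin.val_succ, trajectory_cons, Fin.cons_succ, Fin.cons_zero, Fin.val_zero]
      rfl
    have he : ∀ F : (Fin (n + 1) → Ω) → ℝ,
        ∑ ω, F ω = ∑ ξ : Ω, ∑ ω : Fin n → Ω, F (Fin.cons ξ ω) := by
      intro F
      rw [← (Fin.consEquiv fun _ => Ω).sum_comp, Fintype.sum_prod_type]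
      rfl
    constructor
    · rw [he]
      simp only [hp]
      rw [← hsum w hw]
      refine Finset.sum_congr rfl fun ξ _ => ?_
      rw [← Finset.mul_sum, (ih _ (hstep w hw ξ)).1, mul_one]
    · rw [he]
      simp only [hp, hs]
      calc _ = ∑ ξ, prob w ξ * (Y w ξ
            + ∑ ω : Fin n → Ω, (∏ t : Fin n, prob (trajectory step (step w ξ) ω t) (ω t)) *
              ∑ t : Fin n, Y (trajectory step (step w ξ) ω t) (ω t)) := by
            refine Finset.sum_congr rfl fun ξ _ => ?_
            simp only [mul_add, mul_assoc, Finset.sum_add_distrib]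
            rw [← Finset.mul_sum, ← Finset.mul_sum, ← Finset.sum_mul,
              (ih _ (hstep w hw ξ)).1, one_mul]
        _ ≤ ∑ ξ, prob w ξ * (Y w ξ + n * B) := Finset.sum_le_sum fun ξ _ =>
            mul_le_mul_of_nonneg_left (by linarith [(ih _ (hstep w hw ξ)).2]) (hprob w hw ξ)
        _ = ∑ ξ, prob w ξ * Y w ξ + n * B := by
            simp only [mul_add, Finset.sum_add_distrib]
            rw [← Finset.sum_mul, hsum w hw, one_mul]
        _ ≤ ((n + 1 : ℕ) : ℝ) * B := by
            push_cast
            linarith [hY w hw]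

variable {P : Ω → ℝ} {ι : Type*} [Fintype ι]

/-- Unbiased noise has mean zero against a fixed vector. -/
lemma sum_noise_eq_zero {g : Ω → ι → ℝ} {m : ι → ℝ} (hP : ∑ ξ, P ξ = 1)
    (hm : ∀ l, ∑ ξ, P ξ * g ξ l = m l) (c : ι → ℝ) :
    ∑ ξ, P ξ * ∑ l, (m l - g ξ l) * c l = 0 := by
  simp only [Finset.mul_sum]
  rw [Finset.sum_comm]
  refine Finset.sum_eq_zero fun l _ => ?_
  calc ∑ ξ, P ξ * ((m l - g ξ l) * c l) = (m l * ∑ ξ, P ξ - ∑ ξ, P ξ * g ξ l) * c l := by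
        rw [Finset.mul_sum, ← Finset.sum_sub_distrib, Finset.sum_mul]
        exact Finset.sum_congr rfl fun ξ _ => by ring
    _ = 0 := by rw [hP, hm]; ring

/-- The variance is at most the second moment. -/
lemma sum_noise_sq_le {g : Ω → ι → ℝ} {m : ι → ℝ} (hP : ∑ ξ, P ξ = 1)
    (hm : ∀ l, ∑ ξ, P ξ * g ξ l = m l) (l : ι) :
    ∑ ξ, P ξ * (m l - g ξ l) ^ 2 ≤ ∑ ξ, P ξ * g ξ l ^ 2 := by
  have : ∑ ξ, P ξ * (m l - g ξ l) ^ 2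
      = m l ^ 2 * ∑ ξ, P ξ - 2 * m l * ∑ ξ, P ξ * g ξ l + ∑ ξ, P ξ * g ξ l ^ 2 := by
    rw [Finset.mul_sum, Finset.mul_sum, ← Finset.sum_sub_distrib, ← Finset.sum_add_distrib]
    exact Finset.sum_congr rfl fun ξ _ => by ring
  rw [this, hP, hm]
  nlinarith [sq_nonneg (m l)]

lemma sum_weighted_sq_le {g : Ω → ι → ℝ} {B c : ℝ} (hg : ∀ l, ∑ ξ, P ξ * g ξ l ^ 2 ≤ B)
    (hB : 0 ≤ B) {x : ι → ℝ} (hx : ∀ l, 0 ≤ x l) (hc : ∑ l, x l ≤ c) :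
    ∑ ξ, P ξ * ∑ l, x l * g ξ l ^ 2 ≤ c * B := by
  calc ∑ ξ, P ξ * ∑ l, x l * g ξ l ^ 2 = ∑ l, x l * ∑ ξ, P ξ * g ξ l ^ 2 := by
        simp only [Finset.mul_sum]
        rw [Finset.sum_comm]
        exact Finset.sum_congr rfl fun l _ => Finset.sum_congr rfl fun ξ _ => by ring
    _ ≤ ∑ l, x l * B := Finset.sum_le_sum fun l _ => mul_le_mul_of_nonneg_left (hg l) (hx l)
    _ ≤ c * B := by rw [← Finset.sum_mul]; exact mul_le_mul_of_nonneg_right hc hB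

end process

/-! ### The sampling law: unbiasedness and second moments of the estimators. -/

section sampling

variable {S : Type u} {A : S → Type v} {K : Type w}
  [Fintype S] [DecidableEq S] [∀ i, Fintype (A i)] [∀ i, DecidableEq (A i)]
  [Fintype K] [DecidableEq K] {M : MDP S A} {d : K → Pair S A → ℝ} {z : Iterate S A K}

lemma sum_prod_three {α β γ : Type*} [Fintype α] [Fintype β] [Fintype γ] (a : α → ℝ) (b : β → ℝ)
    (c : γ → ℝ) : ∑ ξ : α × β × γ, a ξ.1 * b ξ.2.1 * c ξ.2.2
      = (∑ i, a i) * (∑ j, b j) * ∑ k, c k := by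
  simp only [Fintype.sum_prod_type, ← Finset.mul_sum, ← Finset.sum_mul]

/-- Distribution of the draw for the `v`-gradient. -/
noncomputable def probV (M : MDP S A) (z : Iterate S A K) (y : Pair S A × S) : ℝ :=
  z.μ y.1 * M.p y.1.1 y.1.2 y.2

/-- Distribution of the draw for the `s`-gradient. -/
noncomputable def probS (z : Iterate S A K) (y : Pair S A × K) : ℝ :=
  z.μ y.1 * (1 / Fintype.card K)

/-- Distribution of the draw for the `μ`-gradient. -/
noncomputable def probMu (M : MDP S A) (z : Iterate S A K) (y : Pair S A × S × K) : ℝ :=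
  (1 / Fintype.card (Pair S A)) * M.p y.1.1 y.1.2 y.2.1 * (z.s y.2.2 / ∑ k, z.s k)

lemma sampleProb_eq (ξ : Sample S A K) :
    sampleProb M z ξ = probV M z ξ.1 * probS z ξ.2.1 * probMu M z ξ.2.2 := rfl

lemma sum_probV (hμ : z.μ ∈ stdSimplex ℝ (Pair S A)) : ∑ y, probV M z y = 1 := by
  simp only [probV, Fintype.sum_prod_type]
  rw [← hμ.2]
  exact Finset.sum_congr rfl fun x _ => by rw [← Finset.mul_sum, (M.p_mem _ _).2, mul_one]

lemma sum_probS [Nonempty K] (hμ : z.μ ∈ stdSimplex ℝ (Pair S A)) : ∑ y, probS z y = 1 := by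
  simp only [probS, Fintype.sum_prod_type]
  refine Eq.trans ?_ hμ.2
  refine Finset.sum_congr rfl fun x _ => ?_
  rw [Finset.sum_const, Finset.card_univ, nsmul_eq_mul]
  have : (Fintype.card K : ℝ) ≠ 0 := by exact_mod_cast Fintype.card_ne_zero
  field_simp

lemma sum_probMu [Nonempty (Pair S A)] (hs : 0 < ∑ k, z.s k) : ∑ y, probMu M z y = 1 := by
  have hA : (Fintype.card (Pair S A) : ℝ) ≠ 0 := by exact_mod_cast Fintype.card_ne_zero
  simp only [probMu, Fintype.sum_prod_type, ← Finset.mul_sum, ← Finset.sum_div]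
  rw [div_self hs.ne']
  simp only [mul_one, ← Finset.mul_sum, (M.p_mem _ _).2]
  rw [Finset.sum_const, Finset.card_univ, nsmul_eq_mul]
  field_simp

/-- The iterates visited by stochastic mirror descent. -/
structure Regular (M : MDP S A) (d : K → Pair S A → ℝ) (z : Iterate S A K) : Prop where
  v_mem : z.v ∈ valueDomain M d
  s_mem : z.s ∈ multiplierDomain K
  s_pos : ∀ k, 0 < z.s k
  μ_mem : z.μ ∈ stdSimplex ℝ (Pair S A)
  μ_pos : ∀ x, 0 < z.μ x

variable [Nonempty K] [Nonempty (Pair S A)]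

lemma Regular.sum_s_pos (hz : Regular M d z) : 0 < ∑ k, z.s k :=
  Finset.sum_pos (fun k _ => hz.s_pos k) Finset.univ_nonempty

lemma Regular.sampleProb_nonneg (hz : Regular M d z) (ξ : Sample S A K) :
    0 ≤ sampleProb M z ξ := by
  rw [sampleProb_eq]
  unfold probV probS probMu
  have h1 := hz.μ_mem.1
  have h2 := hz.s_mem.1
  have h3 := hz.sum_s_pos
  refine mul_nonneg (mul_nonneg (mul_nonneg (h1 _) ((M.p_mem _ _).1 _))
    (mul_nonneg (h1 _) (by positivity))) (mul_nonneg (mul_nonneg (by positivity)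
    ((M.p_mem _ _).1 _)) (div_nonneg (h2 _) h3.le))

/-- Each estimator reads only one of the three independent draws, so the other two sum out to 1. The
next two lemmas are the same marginalization. -/
lemma Regular.sum_mul_fst (hz : Regular M d z) (F : Pair S A × S → ℝ) :
    ∑ ξ : Sample S A K, sampleProb M z ξ * F ξ.1 = ∑ y, probV M z y * F y := by
  have := sum_prod_three (fun y => probV M z y * F y) (probS z) (probMu M z)
  rw [sum_probS hz.μ_mem, sum_probMu hz.sum_s_pos, mul_one, mul_one] at this
  rw [← this]
  exact Finset.sum_congr rfl fun ξ _ => by rw [sampleProb_eq]; ring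

lemma Regular.sum_mul_snd (hz : Regular M d z) (F : Pair S A × K → ℝ) :
    ∑ ξ : Sample S A K, sampleProb M z ξ * F ξ.2.1 = ∑ y, probS z y * F y := by
  have := sum_prod_three (probV M z) (fun y => probS z y * F y) (probMu M z)
  rw [sum_probV hz.μ_mem, sum_probMu hz.sum_s_pos, mul_one, one_mul] at this
  rw [← this]
  exact Finset.sum_congr rfl fun ξ _ => by rw [sampleProb_eq]; ring

lemma Regular.sum_mul_trd (hz : Regular M d z) (F : Pair S A × S × K → ℝ) :
    ∑ ξ : Sample S A K, sampleProb M z ξ * F ξ.2.2 = ∑ y, probMu M z y * F y := by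
  have := sum_prod_three (probV M z) (probS z) (fun y => probMu M z y * F y)
  rw [sum_probV hz.μ_mem, sum_probS hz.μ_mem, one_mul, one_mul] at this
  rw [← this]
  exact Finset.sum_congr rfl fun ξ _ => by rw [sampleProb_eq]; ring

lemma Regular.sum_sampleProb (hz : Regular M d z) : ∑ ξ, sampleProb M z ξ = 1 := by
  have := hz.sum_mul_fst (fun _ => 1)
  simp only [mul_one] at this
  rw [this, sum_probV hz.μ_mem]

/-- `∇_v f`. -/
noncomputable def meanV (M : MDP S A) (μ : Pair S A → ℝ) (l : S) : ℝ :=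
  ∑ x : Pair S A, μ x * ((if x.1 = l then 1 else 0) - M.p x.1 x.2 l)

/-- `∇_s f`. -/
noncomputable def meanS (d : K → Pair S A → ℝ) (μ : Pair S A → ℝ) (k : K) : ℝ :=
  ∑ x, d k x * μ x - 1

/-- `-∇_μ f`. -/
noncomputable def meanMu (M : MDP S A) (d : K → Pair S A → ℝ) (z : Iterate S A K)
    (x : Pair S A) : ℝ :=
  -((z.v x.1 - ∑ j, M.p x.1 x.2 j * z.v j) + ∑ k, d k x * z.s k)

lemma Regular.sum_gradV (hz : Regular M d z) (l : S) :
    ∑ ξ : Sample S A K, sampleProb M z ξ * gradV ξ l = meanV M z.μ l := by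
  refine (hz.sum_mul_fst fun y => (if l = y.1.1 then 1 else 0) - (if l = y.2 then 1 else 0)).trans ?_
  rw [Fintype.sum_prod_type]
  unfold meanV probV
  refine Finset.sum_congr rfl fun x _ => ?_
  simp only [mul_sub, Finset.sum_sub_distrib]
  congr 1
  · by_cases h : x.1 = l
    · simp [h, ← Finset.mul_sum, (M.p_mem _ _).2]
    · simp [h, Ne.symm h]
  · simp

lemma Regular.sum_gradS (hz : Regular M d z) (l : K) :
    ∑ ξ : Sample S A K, sampleProb M z ξ * gradS d ξ l = meanS d z.μ l := by
  refine (hz.sum_mul_snd fun y =>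
    (if l = y.2 then (Fintype.card K : ℝ) * d y.2 y.1 else 0) - 1).trans ?_
  simp only [mul_sub, Finset.sum_sub_distrib, mul_one]
  rw [sum_probS hz.μ_mem, Fintype.sum_prod_type]
  unfold meanS probS
  congr 1
  refine Finset.sum_congr rfl fun x _ => ?_
  have : (Fintype.card K : ℝ) ≠ 0 := by exact_mod_cast Fintype.card_ne_zero
  simp only [mul_ite, mul_zero, Finset.sum_ite_eq, Finset.mem_univ, if_true]
  field_simp

/-- The number of pairs and `∑ k, z.s k` in the estimator undo the uniform choice of the pair and
the normalization of `s`. -/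
lemma Regular.sum_gradMu (hz : Regular M d z) (l : Pair S A) :
    ∑ ξ : Sample S A K, sampleProb M z ξ * gradMu d z ξ l = meanMu M d z l := by
  refine (hz.sum_mul_trd fun y => if l = y.1 then
      -((Fintype.card (Pair S A) : ℝ) * (z.v y.1.1 - z.v y.2.1 + d y.2.2 y.1 * ∑ l, z.s l))
      else 0).trans ?_
  have hA : (Fintype.card (Pair S A) : ℝ) ≠ 0 := by exact_mod_cast Fintype.card_ne_zero
  have hs := hz.sum_s_pos
  rw [Fintype.sum_prod_type, Finset.sum_eq_single l
    (fun b _ hb => Finset.sum_eq_zero fun y _ => by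
      dsimp only
      rw [if_neg hb.symm, mul_zero])
    (fun h => absurd (Finset.mem_univ l) h)]
  simp only [if_true]
  unfold probMu meanMu
  rw [Fintype.sum_prod_type]
  dsimp only
  set σ := ∑ k, z.s k with hσ
  have h1 : ∀ j k, 1 / (Fintype.card (Pair S A) : ℝ) * M.p l.1 l.2 j * (z.s k / σ) *
      -((Fintype.card (Pair S A) : ℝ) * (z.v l.1 - z.v j + d k l * σ))
      = -(M.p l.1 l.2 j * (z.v l.1 - z.v j) / σ * z.s k + M.p l.1 l.2 j * (d k l * z.s k)) := by
    intro j k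
    field_simp
  simp only [h1, Finset.sum_neg_distrib, Finset.sum_add_distrib, ← Finset.mul_sum, ← hσ]
  congr 2
  · have h2 : ∀ j, M.p l.1 l.2 j * (z.v l.1 - z.v j) / σ * σ
        = M.p l.1 l.2 j * z.v l.1 - M.p l.1 l.2 j * z.v j := by
      intro j
      field_simp
    simp only [h2, Finset.sum_sub_distrib]
    rw [← Finset.sum_mul, (M.p_mem _ _).2, one_mul]
  · rw [← Finset.sum_mul, (M.p_mem _ _).2, one_mul]

lemma sum_gradV_sq_le (ξ : Sample S A K) : ∑ l, gradV ξ l ^ 2 ≤ 4 := by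
  calc ∑ l, gradV ξ l ^ 2
      ≤ ∑ l, (2 * (if l = ξ.1.1.1 then (1 : ℝ) else 0) + 2 * (if l = ξ.1.2 then (1 : ℝ) else 0)) := by
        refine Finset.sum_le_sum fun l _ => ?_
        simp only [gradV]
        split_ifs <;> norm_num
    _ = 4 := by
        rw [Finset.sum_add_distrib, ← Finset.mul_sum, ← Finset.mul_sum]
        simp
        norm_num

/-- The weight `K ^ 2` is met with probability `1 / K`, hence one factor `K` only. The same saving
applies to the number of pairs in `Regular.sum_gradMu_sq_le`. -/
lemma Regular.sum_gradS_sq_le (hz : Regular M d z) (hD : 1 ≤ maxEntry d) (l : K) :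
    ∑ ξ : Sample S A K, sampleProb M z ξ * gradS d ξ l ^ 2
      ≤ 4 * (Fintype.card K * maxEntry d ^ 2) := by
  have hK : (1 : ℝ) ≤ Fintype.card K := by exact_mod_cast Fintype.card_pos
  set k := (Fintype.card K : ℝ) with hk
  have hk0 : k ≠ 0 := by linarith
  calc ∑ ξ : Sample S A K, sampleProb M z ξ * gradS d ξ l ^ 2
      ≤ ∑ ξ : Sample S A K, sampleProb M z ξ *
        (fun y : Pair S A × K => 2 * (if l = y.2 then (k * maxEntry d) ^ 2 else 0) + 2) ξ.2.1 := by
        refine Finset.sum_le_sum fun ξ _ =>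
          mul_le_mul_of_nonneg_left ?_ (hz.sampleProb_nonneg ξ)
        obtain ⟨-, ⟨x, k'⟩, -⟩ := ξ
        simp only [gradS]
        split_ifs
        · have h1 := abs_le.1 (abs_le_maxEntry d k' x)
          have h2 : (k * d k' x) ^ 2 ≤ (k * maxEntry d) ^ 2 := by
            refine sq_le_sq' ?_ ?_ <;> nlinarith [h1.1, h1.2]
          nlinarith [sq_nonneg (k * d k' x + 1)]
        · norm_num
    _ = 2 * (k * maxEntry d ^ 2) + 2 := by
        refine (hz.sum_mul_snd fun y =>
          2 * (if l = y.2 then (k * maxEntry d) ^ 2 else 0) + 2).trans ?_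
        simp only [mul_add, Finset.sum_add_distrib, ← Finset.sum_mul]
        rw [sum_probS hz.μ_mem, Fintype.sum_prod_type]
        unfold probS
        simp only [mul_ite, mul_zero, Finset.sum_ite_eq, Finset.mem_univ, if_true]
        rw [← Finset.sum_mul, ← Finset.sum_mul, hz.μ_mem.2, ← hk]
        field_simp
    _ ≤ 4 * (k * maxEntry d ^ 2) := by nlinarith [one_le_pow₀ (n := 2) hD]

lemma Regular.abs_gradMu_le (hz : Regular M d z) (hD : 1 ≤ maxEntry d)
    (ht : 1 ≤ tmix M) (ξ : Sample S A K) (y : Pair S A) :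
    |gradMu d z ξ y| ≤ if y = ξ.2.2.1 then
      Fintype.card (Pair S A) * (10 * (maxEntry d * tmix M)) else 0 := by
  obtain ⟨-, -, ⟨x, j, k⟩⟩ := ξ
  simp only [gradMu]
  split_ifs
  · rw [abs_neg, abs_mul, Nat.abs_cast]
    refine mul_le_mul_of_nonneg_left ?_ (Nat.cast_nonneg _)
    have h1 := abs_sub_le_of_mem_valueDomain hz.v_mem x.1 j
    have h2 := abs_le_maxEntry d k x
    have h3 : |d k x * ∑ l, z.s l| ≤ maxEntry d * 2 := by
      rw [abs_mul, abs_of_nonneg hz.sum_s_pos.le]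
      exact mul_le_mul h2 hz.s_mem.2 hz.sum_s_pos.le (by linarith)
    have ht' : (1 : ℝ) ≤ tmix M := by exact_mod_cast ht
    have hDt : maxEntry d ≤ maxEntry d * tmix M := le_mul_of_one_le_right (by linarith) ht'
    refine (abs_add_le _ _).trans ?_
    linarith
  · simp

lemma Regular.sum_gradMu_sq_le (hz : Regular M d z) (hD : 1 ≤ maxEntry d)
    (ht : 1 ≤ tmix M) (l : Pair S A) :
    ∑ ξ : Sample S A K, sampleProb M z ξ * gradMu d z ξ l ^ 2
      ≤ Fintype.card (Pair S A) * (10 * (maxEntry d * tmix M)) ^ 2 := by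
  have hA : (1 : ℝ) ≤ Fintype.card (Pair S A) := by exact_mod_cast Fintype.card_pos
  set a := (Fintype.card (Pair S A) : ℝ) with ha
  have ha0 : a ≠ 0 := by linarith
  calc ∑ ξ : Sample S A K, sampleProb M z ξ * gradMu d z ξ l ^ 2
      ≤ ∑ ξ : Sample S A K, sampleProb M z ξ * (fun y : Pair S A × S × K =>
        if l = y.1 then (a * (10 * (maxEntry d * tmix M))) ^ 2 else 0) ξ.2.2 := by
        refine Finset.sum_le_sum fun ξ _ =>
          mul_le_mul_of_nonneg_left ?_ (hz.sampleProb_nonneg ξ)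
        have h := hz.abs_gradMu_le hD ht ξ l
        rw [← sq_abs]
        dsimp only
        split_ifs at h ⊢
        · exact pow_le_pow_left₀ (abs_nonneg _) h 2
        · rw [le_antisymm h (abs_nonneg _)]
          norm_num
    _ = a * (10 * (maxEntry d * tmix M)) ^ 2 := by
        refine (hz.sum_mul_trd fun y =>
          if l = y.1 then (a * (10 * (maxEntry d * tmix M))) ^ 2 else 0).trans ?_
        rw [Fintype.sum_prod_type, Finset.sum_eq_single l
          (fun b _ hb => Finset.sum_eq_zero fun y _ => by
            dsimp only
            rw [if_neg hb.symm, mul_zero])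
          (fun h => absurd (Finset.mem_univ l) h)]
        simp only [if_true]
        rw [← Finset.sum_mul]
        have : ∑ y, probMu M z (l, y) = 1 / a := by
          simp only [probMu, Fintype.sum_prod_type, ← Finset.mul_sum, ← Finset.sum_div]
          rw [div_self hz.sum_s_pos.ne']
          simp only [mul_one, ← Finset.mul_sum, (M.p_mem _ _).2, ha]
        rw [this]
        field_simp

end sampling

/-! ### Regret of stochastic mirror descent with auxiliary iterates. -/

section descent

variable {S : Type u} {A : S → Type v} {K : Type w}
  [Fintype S] [DecidableEq S] [∀ i, Fintype (A i)] [∀ i, DecidableEq (A i)]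
  [Fintype K] [DecidableEq K]

/-- Inserting the value at `z` itself splits the difference into a primal and a dual part; since `f`
is affine in each, the first-order expansions are identities. -/
lemma objective_sub_eq (M : MDP S A) (d : K → Pair S A → ℝ) (z : Iterate S A K) (v : S → ℝ)
    (s : K → ℝ) (μ : Pair S A → ℝ) :
    objective M d z.v z.s μ - objective M d v s z.μ
      = ∑ l, meanV M z.μ l * (z.v l - v l) + ∑ l, meanS d z.μ l * (z.s l - s l)
        + ∑ x, meanMu M d z x * (z.μ x - μ x) := by
  have h1 : ∑ l, meanV M z.μ l * (z.v l - v l) + ∑ l, meanS d z.μ l * (z.s l - s l)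
      = objective M d z.v z.s z.μ - objective M d v s z.μ := by
    rw [objective_eq, objective_eq]
    change _ = (∑ l, z.v l * meanV M z.μ l + ∑ l, z.s l * meanS d z.μ l)
      - (∑ l, v l * meanV M z.μ l + ∑ l, s l * meanS d z.μ l)
    rw [add_sub_add_comm, ← Finset.sum_sub_distrib, ← Finset.sum_sub_distrib]
    congr 1 <;> exact Finset.sum_congr rfl fun l _ => by ring
  have h2 : ∑ x, meanMu M d z x * (z.μ x - μ x)
      = objective M d z.v z.s μ - objective M d z.v z.s z.μ := by
    unfold objective meanMu
    rw [sub_sub_sub_cancel_right, ← Finset.sum_sub_distrib]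
    exact Finset.sum_congr rfl fun x _ => by ring
  rw [h1, h2]
  ring

/-- An iterate together with two auxiliary iterates, in `v` and in `s`, that are driven by the
noise of the gradient estimators. -/
structure Tracked (S : Type u) (A : S → Type v) (K : Type w) where
  z : Iterate S A K
  v : S → ℝ
  s : K → ℝ

/-- One round for the iterate and the auxiliary iterates. -/
noncomputable def trackedStep (M : MDP S A) (d : K → Pair S A → ℝ) (ηv ηs ημ : ℝ)
    (w : Tracked S A K) (ξ : Sample S A K) : Tracked S A K where
  z := smdStep M d ηv ηs ημ w.z ξ
  v := mirrorStep euclidDiv (valueDomain M d) ηv (fun l => meanV M w.z.μ l - gradV ξ l) w.v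
  s := mirrorStep klDivergence (multiplierDomain K) ηs
    (fun l => meanS d w.z.μ l - gradS d ξ l) w.s

/-- The part of the regret of one round that does not telescope. -/
noncomputable def roundCost (M : MDP S A) (d : K → Pair S A → ℝ) (ηv ηs ημ : ℝ)
    (μ₀ : Pair S A → ℝ) (w : Tracked S A K) (ξ : Sample S A K) : ℝ :=
  ηv * ((∑ l, gradV ξ l ^ 2) / 2) + ηv * ((∑ l, (meanV M w.z.μ l - gradV ξ l) ^ 2) / 2)
  + ηs * ∑ l, w.z.s l * gradS d ξ l ^ 2
  + ηs * ∑ l, w.s l * (meanS d w.z.μ l - gradS d ξ l) ^ 2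
  + ημ * ∑ x, w.z.μ x * gradMu d w.z ξ x ^ 2
  + ∑ l, (meanV M w.z.μ l - gradV ξ l) * (w.z.v l - w.v l)
  + ∑ l, (meanS d w.z.μ l - gradS d ξ l) * (w.z.s l - w.s l)
  + ∑ x, (meanMu M d w.z x - gradMu d w.z ξ x) * (w.z.μ x - μ₀ x)

/-- The part of the regret that telescopes. -/
noncomputable def potential (ηv ηs ημ : ℝ) (v : S → ℝ) (s : K → ℝ) (μ₀ : Pair S A → ℝ)
    (w : Tracked S A K) : ℝ :=
  (euclidDiv w.z.v v + euclidDiv w.v v) / ηv + (klDivergence w.z.s s + klDivergence w.s s) / ηs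
    + klDivergence w.z.μ μ₀ / ημ

/-- Invariant of the tracked iterates. -/
structure TrackedRegular (M : MDP S A) (d : K → Pair S A → ℝ) (w : Tracked S A K) : Prop where
  reg : Regular M d w.z
  s_mem : w.s ∈ multiplierDomain K
  s_pos : ∀ k, 0 < w.s k

variable {M : MDP S A} {d : K → Pair S A → ℝ} {ηv ηs ημ : ℝ}

/-- Here `m` is the true gradient, `g` its estimate, `x` the iterate, `y` the auxiliary iterate and
`c` the comparator. The first two sums are regrets, and the third has mean zero. -/
lemma sum_mul_sub_split {ι : Type*} [Fintype ι] (m g x y c : ι → ℝ) :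
    ∑ l, m l * (x l - c l) = ∑ l, g l * (x l - c l) + ∑ l, (m l - g l) * (y l - c l)
      + ∑ l, (m l - g l) * (x l - y l) := by
  rw [← Finset.sum_add_distrib, ← Finset.sum_add_distrib]
  exact Finset.sum_congr rfl fun l _ => by ring

lemma valueDomain_radius_nonneg (M : MDP S A) (d : K → Pair S A → ℝ) :
    0 ≤ 2 * (2 * maxEntry d * tmix M) := by
  have := maxEntry_nonneg d
  positivity

variable [Nonempty K] [Nonempty (Pair S A)]

lemma Regular.smdStep {z : Iterate S A K} (hz : Regular M d z) (ξ : Sample S A K) :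
    Regular M d (smdStep M d ηv ηs ημ z ξ) where
  v_mem := (mirrorStep_box ηv _ (valueDomain_radius_nonneg M d) (gradV ξ) z.v).1
  s_mem := (mirrorStep_multiplierDomain ηs (gradS d ξ) hz.s_pos).1
  s_pos := (mirrorStep_multiplierDomain ηs (gradS d ξ) hz.s_pos).2.1
  μ_mem := (mirrorStep_stdSimplex ημ (gradMu d z ξ) hz.μ_pos).1
  μ_pos := (mirrorStep_stdSimplex ημ (gradMu d z ξ) hz.μ_pos).2.1

lemma TrackedRegular.trackedStep {w : Tracked S A K} (hw : TrackedRegular M d w)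
    (ξ : Sample S A K) : TrackedRegular M d (trackedStep M d ηv ηs ημ w ξ) where
  reg := hw.reg.smdStep ξ
  s_mem := (mirrorStep_multiplierDomain ηs _ hw.s_pos).1
  s_pos := (mirrorStep_multiplierDomain ηs _ hw.s_pos).2.1

lemma potential_nonneg (hηv : 0 < ηv) (hηs : 0 < ηs) (hημ : 0 < ημ) {v : S → ℝ} {s : K → ℝ}
    {μ₀ : Pair S A → ℝ} (hs : ∀ k, 0 ≤ s k) (hμ₀ : ∀ x, 0 ≤ μ₀ x) {w : Tracked S A K}
    (hw : TrackedRegular M d w) : 0 ≤ potential ηv ηs ημ v s μ₀ w := by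
  unfold potential
  have h1 := euclidDiv_nonneg w.z.v v
  have h2 := euclidDiv_nonneg w.v v
  have h3 := klDivergence_nonneg hw.reg.s_pos hs
  have h4 := klDivergence_nonneg hw.s_pos hs
  have h5 := klDivergence_nonneg hw.reg.μ_pos hμ₀
  positivity

lemma abs_gradS_le (hD : 1 ≤ maxEntry d) (ξ : Sample S A K) (l : K) :
    |gradS d ξ l| ≤ 2 * (Fintype.card K * maxEntry d) := by
  have hK : (1 : ℝ) ≤ Fintype.card K := by exact_mod_cast Fintype.card_pos
  have hKD : 1 ≤ Fintype.card K * maxEntry d := one_le_mul_of_one_le_of_one_le hK hD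
  obtain ⟨-, ⟨x, k⟩, -⟩ := ξ
  simp only [gradS]
  split_ifs
  · refine (abs_sub _ _).trans ?_
    rw [abs_mul, Nat.abs_cast, abs_one]
    have := mul_le_mul_of_nonneg_left (abs_le_maxEntry d k x) (Nat.cast_nonneg (Fintype.card K))
    linarith
  · rw [zero_sub, abs_neg, abs_one]
    linarith

/-- The constants `-1` cancel, and nonnegative entries place both remaining terms in `[0, K D]`. The
spare factor 2 lets one step-size condition serve here and for `abs_gradS_le`. -/
lemma abs_meanS_sub_gradS_le {μ : Pair S A → ℝ} (hμ : μ ∈ stdSimplex ℝ (Pair S A))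
    (hd : ∀ k x, 0 ≤ d k x) (ξ : Sample S A K) (l : K) :
    |meanS d μ l - gradS d ξ l| ≤ 2 * (Fintype.card K * maxEntry d) := by
  have hK : (1 : ℝ) ≤ Fintype.card K := by exact_mod_cast Fintype.card_pos
  have hD := maxEntry_nonneg d
  have hKD : maxEntry d ≤ Fintype.card K * maxEntry d := le_mul_of_one_le_left hD hK
  have h1 := sum_mul_le_maxEntry (d := d) hμ l
  have h2 : 0 ≤ ∑ x, d l x * μ x := Finset.sum_nonneg fun x _ => mul_nonneg (hd l x) (hμ.1 x)
  obtain ⟨-, ⟨x, k⟩, -⟩ := ξ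
  simp only [gradS, meanS]
  rw [sub_sub_sub_cancel_right, abs_le]
  have h3 := mul_le_mul_of_nonneg_left ((le_abs_self _).trans (abs_le_maxEntry d k x))
    (Nat.cast_nonneg (α := ℝ) (Fintype.card K))
  have h4 := mul_nonneg (Nat.cast_nonneg (α := ℝ) (Fintype.card K)) (hd k x)
  split_ifs <;> constructor <;> linarith

/-- Regret of one round against a point of the primal domain and a feasible `μ₀`. -/
lemma neg_objective_le_round (hd : ∀ k x, 0 ≤ d k x) (hD : 1 ≤ maxEntry d) (ht : 1 ≤ tmix M)
    (hηv : 0 < ηv) (hηs : 0 < ηs) (hημ : 0 < ημ)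
    (hηs1 : ηs * (2 * (Fintype.card K * maxEntry d)) ≤ 1)
    (hημ1 : ημ * (Fintype.card (Pair S A) * (10 * (maxEntry d * tmix M))) ≤ 1)
    {μ₀ : Pair S A → ℝ} (hμ₀ : IsApproxSolution M d 0 μ₀) {v : S → ℝ} (hv : v ∈ valueDomain M d)
    {s : K → ℝ} (hs : s ∈ multiplierDomain K) {w : Tracked S A K} (hw : TrackedRegular M d w)
    (ξ : Sample S A K) :
    -objective M d v s w.z.μ ≤ potential ηv ηs ημ v s μ₀ w
      - potential ηv ηs ημ v s μ₀ (trackedStep M d ηv ηs ημ w ξ)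
      + roundCost M d ηv ηs ημ μ₀ w ξ := by
  have h0 := objective_nonneg_of_feasible hμ₀ w.z.v hw.reg.s_mem.1
  have hid := objective_sub_eq M d w.z v s μ₀
  have hb := valueDomain_radius_nonneg M d
  have hv1 := regret_box (g := gradV ξ) (x := w.z.v) hηv hb hv
  have hv2 := regret_box (g := fun l => meanV M w.z.μ l - gradV ξ l) (x := w.v) hηv hb hv
  have hbd : ∀ {η g B : ℝ}, 0 < η → |g| ≤ B → η * B ≤ 1 → |η * g| ≤ 1 := by
    intro η g B hη hg hB
    rw [abs_mul, abs_of_pos hη]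
    exact (mul_le_mul_of_nonneg_left hg hη.le).trans hB
  have hs1 := regret_multiplierDomain (g := gradS d ξ) (x := w.z.s) hηs hw.reg.s_pos
    (fun l => hbd hηs (abs_gradS_le hD ξ l) hηs1) hs
  have hs2 := regret_multiplierDomain (g := fun l => meanS d w.z.μ l - gradS d ξ l) (x := w.s)
    hηs hw.s_pos (fun l => hbd hηs (abs_meanS_sub_gradS_le hw.reg.μ_mem hd ξ l) hηs1) hs
  have hm1 := regret_stdSimplex (g := gradMu d w.z ξ) (x := w.z.μ) hημ hw.reg.μ_pos
    (fun y => hbd hημ ((hw.reg.abs_gradMu_le hD ht ξ y).trans (by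
      split_ifs
      · exact le_rfl
      · have := maxEntry_nonneg d
        positivity)) hημ1) hμ₀.1
  -- Since `μ₀` is fixed before any draw, the noise against it already has mean zero.
  have em : ∑ x, meanMu M d w.z x * (w.z.μ x - μ₀ x)
      = ∑ x, gradMu d w.z ξ x * (w.z.μ x - μ₀ x)
        + ∑ x, (meanMu M d w.z x - gradMu d w.z ξ x) * (w.z.μ x - μ₀ x) := by
    rw [← Finset.sum_add_distrib]
    exact Finset.sum_congr rfl fun l _ => by ring
  rw [sum_mul_sub_split (meanV M w.z.μ) (gradV ξ) w.z.v w.v v,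
    sum_mul_sub_split (meanS d w.z.μ) (gradS d ξ) w.z.s w.s s, em] at hid
  unfold potential roundCost
  simp only [trackedStep, smdStep, add_div]
  simp only [sub_div] at hv1 hv2 hs1 hs2 hm1
  change _ ≤ _ - euclidDiv (mirrorStep euclidDiv (valueDomain M d) ηv _ w.z.v) v / ηv + _ at hv1
  change _ ≤ _ - euclidDiv (mirrorStep euclidDiv (valueDomain M d) ηv _ w.v) v / ηv + _ at hv2
  linarith

/-- Expected cost of one round. -/
lemma expected_roundCost_le (hD : 1 ≤ maxEntry d) (ht : 1 ≤ tmix M)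
    (hηv : 0 < ηv) (hηs : 0 < ηs) (hημ : 0 < ημ) (μ₀ : Pair S A → ℝ)
    {w : Tracked S A K} (hw : TrackedRegular M d w) :
    ∑ ξ, sampleProb M w.z ξ * roundCost M d ηv ηs ημ μ₀ w ξ
      ≤ 4 * ηv + 16 * (ηs * (Fintype.card K * maxEntry d ^ 2))
        + 100 * (ημ * (Fintype.card (Pair S A) * (maxEntry d * tmix M) ^ 2)) := by
  have hz := hw.reg
  set P := sampleProb M w.z with hP
  have hP1 : ∑ ξ, P ξ = 1 := hz.sum_sampleProb
  have hP0 : ∀ ξ, 0 ≤ P ξ := hz.sampleProb_nonneg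
  have h1 : ∑ ξ, P ξ * ∑ l, gradV ξ l ^ 2 ≤ 4 := by
    calc ∑ ξ, P ξ * ∑ l, gradV ξ l ^ 2 ≤ ∑ ξ, P ξ * 4 :=
          Finset.sum_le_sum fun ξ _ => mul_le_mul_of_nonneg_left (sum_gradV_sq_le ξ) (hP0 ξ)
      _ = 4 := by rw [← Finset.sum_mul, hP1, one_mul]
  have h2 : ∑ ξ, P ξ * ∑ l, (meanV M w.z.μ l - gradV ξ l) ^ 2 ≤ 4 := by
    refine le_trans ?_ h1
    simp only [Finset.mul_sum]
    rw [Finset.sum_comm, Finset.sum_comm (f := fun ξ l => P ξ * gradV ξ l ^ 2)]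
    exact Finset.sum_le_sum fun l _ => sum_noise_sq_le (g := gradV) hP1 hz.sum_gradV l
  have hB : 0 ≤ 4 * ((Fintype.card K : ℝ) * maxEntry d ^ 2) := by positivity
  have h3 : ∑ ξ, P ξ * ∑ l, w.z.s l * gradS d ξ l ^ 2
      ≤ 2 * (4 * (Fintype.card K * maxEntry d ^ 2)) :=
    sum_weighted_sq_le (hz.sum_gradS_sq_le hD) hB hz.s_mem.1 hz.s_mem.2
  have h4 : ∑ ξ, P ξ * ∑ l, w.s l * (meanS d w.z.μ l - gradS d ξ l) ^ 2
      ≤ 2 * (4 * (Fintype.card K * maxEntry d ^ 2)) :=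
    sum_weighted_sq_le (g := fun ξ l => meanS d w.z.μ l - gradS d ξ l)
      (fun l => (sum_noise_sq_le hP1 hz.sum_gradS l).trans (hz.sum_gradS_sq_le hD l)) hB
      hw.s_mem.1 hw.s_mem.2
  have h5 : ∑ ξ, P ξ * ∑ x, w.z.μ x * gradMu d w.z ξ x ^ 2
      ≤ 1 * (Fintype.card (Pair S A) * (10 * (maxEntry d * tmix M)) ^ 2) :=
    sum_weighted_sq_le (hz.sum_gradMu_sq_le hD ht) (by positivity) hz.μ_mem.1 hz.μ_mem.2.le
  -- The iterates and auxiliary iterates in `w` do not depend on the current draw.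
  have h6 := sum_noise_eq_zero hP1 hz.sum_gradV fun l => w.z.v l - w.v l
  have h7 := sum_noise_eq_zero hP1 hz.sum_gradS fun l => w.z.s l - w.s l
  have h8 := sum_noise_eq_zero hP1 hz.sum_gradMu fun x => w.z.μ x - μ₀ x
  have e : ∑ ξ, P ξ * roundCost M d ηv ηs ημ μ₀ w ξ
      = ηv / 2 * ∑ ξ, P ξ * ∑ l, gradV ξ l ^ 2
        + ηv / 2 * ∑ ξ, P ξ * ∑ l, (meanV M w.z.μ l - gradV ξ l) ^ 2
        + ηs * ∑ ξ, P ξ * ∑ l, w.z.s l * gradS d ξ l ^ 2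
        + ηs * ∑ ξ, P ξ * ∑ l, w.s l * (meanS d w.z.μ l - gradS d ξ l) ^ 2
        + ημ * ∑ ξ, P ξ * ∑ x, w.z.μ x * gradMu d w.z ξ x ^ 2
        + ∑ ξ, P ξ * ∑ l, (meanV M w.z.μ l - gradV ξ l) * (w.z.v l - w.v l)
        + ∑ ξ, P ξ * ∑ l, (meanS d w.z.μ l - gradS d ξ l) * (w.z.s l - w.s l)
        + ∑ ξ, P ξ * ∑ x, (meanMu M d w.z x - gradMu d w.z ξ x) * (w.z.μ x - μ₀ x) := by
    simp only [Finset.mul_sum (s := (Finset.univ : Finset (Sample S A K))),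
      ← Finset.sum_add_distrib]
    refine Finset.sum_congr rfl fun ξ _ => ?_
    unfold roundCost
    ring
  rw [e, h6, h7, h8]
  have i1 := mul_le_mul_of_nonneg_left h1 (half_pos hηv).le
  have i2 := mul_le_mul_of_nonneg_left h2 (half_pos hηv).le
  have i3 := mul_le_mul_of_nonneg_left h3 hηs.le
  have i4 := mul_le_mul_of_nonneg_left h4 hηs.le
  have i5 := mul_le_mul_of_nonneg_left h5 hημ.le
  have e5 : ημ * (1 * (Fintype.card (Pair S A) * (10 * (maxEntry d * tmix M)) ^ 2))
      = 100 * (ημ * (Fintype.card (Pair S A) * (maxEntry d * tmix M) ^ 2)) := by ring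
  linarith

/-- The starting point of the tracked process. -/
noncomputable def trackedInit (v₁ : S → ℝ) : Tracked S A K where
  z := smdInit v₁
  v := v₁
  s := fun _ => 1 / Fintype.card K

lemma trackedInit_regular {v₁ : S → ℝ} (hv₁ : v₁ ∈ valueDomain M d) :
    TrackedRegular M d (trackedInit v₁ : Tracked S A K) := by
  have hK : (0 : ℝ) < Fintype.card K := by exact_mod_cast Fintype.card_pos
  have hA : (0 : ℝ) < Fintype.card (Pair S A) := by exact_mod_cast Fintype.card_pos
  have hs : (fun _ : K => 1 / (Fintype.card K : ℝ)) ∈ multiplierDomain K := by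
    refine ⟨fun _ => by positivity, ?_⟩
    rw [Finset.sum_const, Finset.card_univ, nsmul_eq_mul, mul_one_div_cancel hK.ne']
    norm_num
  refine ⟨⟨hv₁, hs, fun _ => ?_, ⟨fun _ => ?_, ?_⟩, fun _ => ?_⟩, hs, fun _ => ?_⟩
  · change (0 : ℝ) < 1 / _
    positivity
  · change (0 : ℝ) ≤ 1 / _
    positivity
  · change ∑ _ : Pair S A, 1 / (Fintype.card (Pair S A) : ℝ) = 1
    rw [Finset.sum_const, Finset.card_univ, nsmul_eq_mul, mul_one_div_cancel hA.ne']
  · change (0 : ℝ) < 1 / _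
    positivity
  · change (0 : ℝ) < 1 / _
    positivity

lemma trajectory_z (v₁ : S → ℝ) {n : ℕ} (ω : Fin n → Sample S A K) (t : ℕ) :
    (trajectory (trackedStep M d ηv ηs ημ) (trackedInit v₁) ω t).z
      = smdIter M d ηv ηs ημ v₁ ω t := by
  induction t with
  | zero => rfl
  | succ t ih =>
    rw [trajectory, smdIter]
    split_ifs
    · rw [← ih]
      rfl
    · exact ih

/-- No coordinate exceeds the total mass `b`, so each logarithm is at most `log (b * card)`. -/
lemma klDivergence_uniform_le {ι : Type*} [Fintype ι] [Nonempty ι] {y : ι → ℝ} {b : ℝ}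
    (hb : 1 ≤ b) (hy : ∀ i, 0 ≤ y i) (hsum : ∑ i, y i ≤ b) :
    klDivergence (fun _ => 1 / (Fintype.card ι : ℝ)) y
      ≤ b * Real.log (b * Fintype.card ι) - ∑ i, y i + 1 := by
  have hK : (1 : ℝ) ≤ Fintype.card ι := by exact_mod_cast Fintype.card_pos
  have hlog : 0 ≤ Real.log (b * Fintype.card ι) :=
    Real.log_nonneg (one_le_mul_of_one_le_of_one_le hb hK)
  have h1 : ∀ i, y i * Real.log (y i / (1 / (Fintype.card ι : ℝ)))
      ≤ y i * Real.log (b * Fintype.card ι) := by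
    intro i
    rcases (hy i).eq_or_lt with h | h
    · simp [← h]
    · refine mul_le_mul_of_nonneg_left (Real.log_le_log (by positivity) ?_) (hy i)
      rw [div_div_eq_mul_div, div_one]
      exact mul_le_mul_of_nonneg_right
        ((Finset.single_le_sum (fun i _ => hy i) (Finset.mem_univ i)).trans hsum) (by linarith)
  unfold klDivergence
  rw [Finset.sum_add_distrib, Finset.sum_sub_distrib, Finset.sum_const, Finset.card_univ,
    nsmul_eq_mul, mul_one_div_cancel (by linarith)]
  have h2 : ∑ i, y i * Real.log (y i / (1 / (Fintype.card ι : ℝ)))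
      ≤ b * Real.log (b * Fintype.card ι) := by
    refine (Finset.sum_le_sum fun i _ => h1 i).trans ?_
    rw [← Finset.sum_mul]
    exact mul_le_mul_of_nonneg_right hsum hlog
  dsimp only
  linarith

lemma card_le_card_pair [∀ i, Nonempty (A i)] : Fintype.card S ≤ Fintype.card (Pair S A) :=
  Fintype.card_le_of_surjective Sigma.fst fun i => ⟨⟨i, Classical.arbitrary _⟩, rfl⟩

/-- The iterate and its auxiliary copy start at the same point, which doubles the `v` and `s` terms.
States number at most as many as pairs. -/
lemma potential_trackedInit_le [∀ i, Nonempty (A i)] (hηv : 0 < ηv) (hηs : 0 < ηs) (hημ : 0 < ημ)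
    {v₁ v : S → ℝ} (hv₁ : v₁ ∈ valueDomain M d) (hv : v ∈ valueDomain M d) {s : K → ℝ}
    (hs : s ∈ multiplierDomain K) {μ₀ : Pair S A → ℝ} (hμ₀ : μ₀ ∈ stdSimplex ℝ (Pair S A)) :
    potential ηv ηs ημ v s μ₀ (trackedInit v₁)
      ≤ 64 * (Fintype.card (Pair S A) * (maxEntry d * tmix M) ^ 2) / ηv
        + (4 * Real.log (2 * Fintype.card K) + 2) / ηs
        + Real.log (Fintype.card (Pair S A)) / ημ := by
  have h1 : euclidDiv v₁ v ≤ 32 * (Fintype.card (Pair S A) * (maxEntry d * tmix M) ^ 2) := by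
    unfold euclidDiv
    have hle : ∀ i ∈ Finset.univ, (v₁ i - v i) ^ 2 ≤ (8 * (maxEntry d * tmix M)) ^ 2 := by
      intro i _
      have a1 := abs_le.1 (hv₁ i)
      have a2 := abs_le.1 (hv i)
      refine sq_le_sq' ?_ ?_ <;> linarith [a1.1, a1.2, a2.1, a2.2]
    have h2 := Finset.sum_le_sum hle
    rw [Finset.sum_const, Finset.card_univ, nsmul_eq_mul] at h2
    have h3 : (Fintype.card S : ℝ) * (8 * (maxEntry d * tmix M)) ^ 2
        ≤ Fintype.card (Pair S A) * (8 * (maxEntry d * tmix M)) ^ 2 :=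
      mul_le_mul_of_nonneg_right (by exact_mod_cast card_le_card_pair) (sq_nonneg _)
    nlinarith
  have h2 := klDivergence_uniform_le (by norm_num) hs.1 hs.2
  have h3 := klDivergence_uniform_le le_rfl hμ₀.1 hμ₀.2.le
  rw [hμ₀.2, one_mul, one_mul] at h3
  have h4 : 0 ≤ ∑ k, s k := Finset.sum_nonneg fun k _ => hs.1 k
  unfold potential
  change (euclidDiv v₁ v + euclidDiv v₁ v) / ηv
    + (klDivergence (fun _ => 1 / (Fintype.card K : ℝ)) s
      + klDivergence (fun _ => 1 / (Fintype.card K : ℝ)) s) / ηs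
    + klDivergence (fun _ => 1 / (Fintype.card (Pair S A) : ℝ)) μ₀ / ημ ≤ _
  exact add_le_add (add_le_add (div_le_div_of_nonneg_right (by linarith) hηv.le)
    (div_le_div_of_nonneg_right (by linarith) hηs.le))
    (div_le_div_of_nonneg_right (by linarith) hημ.le)

lemma objective_smdOutput (v₁ v : S → ℝ) (s : K → ℝ) {n : ℕ} (ω : Fin n → Sample S A K) :
    objective M d v s (smdOutput M d ηv ηs ημ v₁ ω)
      = (∑ t ∈ Finset.range (n + 1), objective M d v s (smdIter M d ηv ηs ημ v₁ ω t).μ)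
        / (n + 1) := by
  have hn : (n : ℝ) + 1 ≠ 0 := by positivity
  unfold objective smdOutput
  rw [Finset.sum_sub_distrib, Finset.sum_const, Finset.card_range, nsmul_eq_mul, sub_div]
  push_cast
  rw [mul_div_cancel_left₀ _ hn]
  congr 1
  rw [Finset.sum_comm, Finset.sum_div]
  refine Finset.sum_congr rfl fun x _ => ?_
  rw [← Finset.sum_mul]
  ring

/-- Pathwise regret bound for the averaged iterate. -/
lemma neg_objective_smdOutput_le [∀ i, Nonempty (A i)] (hd : ∀ k x, 0 ≤ d k x)
    (hD : 1 ≤ maxEntry d) (ht : 1 ≤ tmix M)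
    (hηv : 0 < ηv) (hηs : 0 < ηs) (hημ : 0 < ημ)
    (hηs1 : ηs * (2 * (Fintype.card K * maxEntry d)) ≤ 1)
    (hημ1 : ημ * (Fintype.card (Pair S A) * (10 * (maxEntry d * tmix M))) ≤ 1)
    {μ₀ : Pair S A → ℝ} (hμ₀ : IsApproxSolution M d 0 μ₀) {v₁ v : S → ℝ}
    (hv₁ : v₁ ∈ valueDomain M d) (hv : v ∈ valueDomain M d)
    {s : K → ℝ} (hs : s ∈ multiplierDomain K) {n : ℕ} (ω : Fin n → Sample S A K) :
    -objective M d v s (smdOutput M d ηv ηs ημ v₁ ω)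
      ≤ (64 * (Fintype.card (Pair S A) * (maxEntry d * tmix M) ^ 2) / ηv
        + (4 * Real.log (2 * Fintype.card K) + 2) / ηs
        + Real.log (Fintype.card (Pair S A)) / ημ + 12 * (maxEntry d * tmix M)
        + ∑ t : Fin n, roundCost M d ηv ηs ημ μ₀
            (trajectory (trackedStep M d ηv ηs ημ) (trackedInit v₁) ω t) (ω t)) / (n + 1) := by
  have hreg : ∀ t, TrackedRegular M d
      (trajectory (trackedStep M d ηv ηs ημ) (trackedInit v₁) ω t) :=
    trajectory_invariant (fun w hw ξ => hw.trackedStep ξ) (trackedInit_regular hv₁) ω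
  set w := trajectory (trackedStep M d ηv ηs ημ) (trackedInit v₁) ω with hw
  have hz : ∀ t, smdIter M d ηv ηs ημ v₁ ω t = (w t).z := fun t => (trajectory_z v₁ ω t).symm
  have hround : ∀ t : Fin n, -objective M d v s (w t).z.μ
      ≤ potential ηv ηs ημ v s μ₀ (w t) - potential ηv ηs ημ v s μ₀ (w (t + 1))
        + roundCost M d ηv ηs ημ μ₀ (w t) (ω t) := by
    intro t
    have e : w (t + 1) = trackedStep M d ηv ηs ημ (w t) (ω t) := by
      rw [hw, trajectory, dif_pos t.2]
    rw [e]
    exact neg_objective_le_round hd hD ht hηv hηs hημ hηs1 hημ1 hμ₀ hv hs (hreg t) (ω t)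
  have hsum := Finset.sum_le_sum fun t (_ : t ∈ Finset.univ) => hround t
  rw [Finset.sum_add_distrib,
    Fin.sum_univ_eq_sum_range (fun t => -objective M d v s (w t).z.μ),
    Fin.sum_univ_eq_sum_range (fun t => potential ηv ηs ημ v s μ₀ (w t)
      - potential ηv ηs ημ v s μ₀ (w (t + 1))), Finset.sum_range_sub'] at hsum
  -- There are `n + 1` iterates but `n` rounds, so the last iterate gets the crude bound.
  have hlast := (abs_le.1 (abs_objective_le hD ht hv hs (hreg n).reg.μ_mem)).1
  have hpn := potential_nonneg hηv hηs hημ (v := v) hs.1 hμ₀.1.1 (hreg n)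
  have hp0 : potential ηv ηs ημ v s μ₀ (w 0) ≤ _ :=
    potential_trackedInit_le hηv hηs hημ hv₁ hv hs hμ₀.1
  rw [objective_smdOutput, ← neg_div]
  refine div_le_div_of_nonneg_right ?_ (by positivity)
  rw [Finset.sum_range_succ]
  simp only [hz]
  rw [Finset.sum_neg_distrib] at hsum
  linarith

lemma smdOutput_pos (v₁ : S → ℝ) (hv₁ : v₁ ∈ valueDomain M d) {n : ℕ}
    (ω : Fin n → Sample S A K) :
    smdOutput M d ηv ηs ημ v₁ ω ∈ stdSimplex ℝ (Pair S A) ∧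
      ∀ x, 0 < smdOutput M d ηv ηs ημ v₁ ω x := by
  have hreg : ∀ t, Regular M d (smdIter M d ηv ηs ημ v₁ ω t) := fun t => by
    rw [← trajectory_z]
    exact (trajectory_invariant (fun w hw ξ => hw.trackedStep ξ) (trackedInit_regular hv₁) ω t).reg
  have hn : (0 : ℝ) < n + 1 := by positivity
  have hpos : ∀ x, 0 < smdOutput M d ηv ηs ημ v₁ ω x := fun x =>
    div_pos (Finset.sum_pos (fun t _ => (hreg t).μ_pos x) (by simp)) hn
  refine ⟨⟨fun x => (hpos x).le, ?_⟩, hpos⟩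
  unfold smdOutput
  rw [← Finset.sum_div, Finset.sum_comm]
  simp only [(hreg _).μ_mem.2]
  rw [Finset.sum_const, Finset.card_range, nsmul_eq_mul, mul_one]
  push_cast
  exact div_self hn.ne'

/-- Positivity gives every state positive mass, so the conditional action distributions are forced.
-/
lemma existsUnique_decomposition [∀ i, Nonempty (A i)] {μ : Pair S A → ℝ}
    (hμ : μ ∈ stdSimplex ℝ (Pair S A)) (hpos : ∀ x, 0 < μ x) :
    ∃! q : (S → ℝ) × ((i : S) → A i → ℝ), IsDecomposition μ q.1 q.2 := by
  have hl : ∀ i, 0 < ∑ a, μ ⟨i, a⟩ := fun i =>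
    Finset.sum_pos (fun a _ => hpos _) Finset.univ_nonempty
  refine ⟨(fun i => ∑ a, μ ⟨i, a⟩, fun i a => μ ⟨i, a⟩ / ∑ a, μ ⟨i, a⟩),
    ⟨⟨fun i => (hl i).le, ?_⟩, fun i => ⟨fun a => div_nonneg (hpos _).le (hl i).le, ?_⟩,
      fun i a => ?_⟩, ?_⟩
  · rw [← hμ.2, Fintype.sum_sigma]
  · dsimp only
    rw [← Finset.sum_div, div_self (hl i).ne']
  · dsimp only
    rw [mul_div_cancel₀ _ (hl i).ne']
  · rintro ⟨lam, π⟩ ⟨hlam, hπ, h⟩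
    dsimp only at hlam hπ h
    have e1 : lam = fun i => ∑ a, μ ⟨i, a⟩ := by
      funext i
      simp only [h]
      rw [← Finset.mul_sum, (hπ i).2, mul_one]
    have e2 : π = fun i a => μ ⟨i, a⟩ / ∑ a, μ ⟨i, a⟩ := by
      funext i a
      rw [eq_div_iff (hl i).ne', h i a, ← congrFun e1 i, mul_comm]
    rw [Prod.mk.injEq]
    exact ⟨e1, e2⟩

end descent

/-- The deterministic part of the regret is at most `162 * ε` per iterate. -/
lemma initial_regret_le {a k D t ε T : ℝ} (ha : 1 ≤ a) (hk : 1 ≤ k) (hka : 2 ≤ k * a)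
    (hD : 1 ≤ D) (ht : 1 ≤ t) (hε : 0 < ε) (hε1 : ε < 1)
    (hT : 1 * ((t ^ 2 * a + k) * D ^ 2 / ε ^ 2 * Real.log (k * a)) ≤ T) :
    64 * (a * (D * t) ^ 2) / (1 * ε) + (4 * Real.log (2 * k) + 2) / (1 / 4 * ε / (k * D ^ 2))
      + Real.log a / (1 / 10 * ε / (t ^ 2 * D ^ 2 * a)) + 12 * (D * t) ≤ 162 * ε * T := by
  set L := Real.log (k * a) with hL
  have hlog2 : (1 / 2 : ℝ) ≤ Real.log 2 := by linarith [Real.log_two_gt_d9]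
  -- From `L ≥ 1/2`, terms without a logarithm are absorbed at the price of a factor 2.
  have hL2 : Real.log 2 ≤ L := Real.log_le_log (by norm_num) hka
  have hLka : L = Real.log k + Real.log a := Real.log_mul (by linarith) (by linarith)
  have hlk := Real.log_nonneg hk
  have hla := Real.log_nonneg ha
  have h2k : Real.log (2 * k) = Real.log 2 + Real.log k := Real.log_mul (by norm_num) (by linarith)
  set X := a * (D * t) ^ 2 / ε with hX
  set Z := k * D ^ 2 / ε with hZ
  have hX0 : 0 ≤ X := by positivity
  have hZ0 : 0 ≤ Z := by positivity
  have hDt : 1 ≤ D * t := one_le_mul_of_one_le_of_one_le hD ht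
  have hDtX : D * t ≤ X := by
    rw [hX, le_div_iff₀ hε]
    calc D * t * ε ≤ D * t * 1 := mul_le_mul_of_nonneg_left hε1.le (by linarith)
      _ ≤ (D * t) ^ 2 := by nlinarith
      _ ≤ a * (D * t) ^ 2 := le_mul_of_one_le_left (sq_nonneg _) ha
  have hT' : X * L + Z * L ≤ ε * T := by
    have := mul_le_mul_of_nonneg_left hT hε.le
    calc X * L + Z * L = ε * (1 * ((t ^ 2 * a + k) * D ^ 2 / ε ^ 2 * L)) := by
          rw [hX, hZ]
          field_simp
      _ ≤ ε * T := this
  have e1 : 64 * (a * (D * t) ^ 2) / (1 * ε) = 64 * X := by rw [hX]; ring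
  have e2 : (4 * Real.log (2 * k) + 2) / (1 / 4 * ε / (k * D ^ 2))
      = 4 * (4 * Real.log (2 * k) + 2) * Z := by
    rw [hZ]
    field_simp
  have e3 : Real.log a / (1 / 10 * ε / (t ^ 2 * D ^ 2 * a)) = 10 * Real.log a * X := by
    rw [hX]
    field_simp
  -- The coefficient of `X * L` is `162 = 128 + 10 + 24`, from the Euclidean term, the entropy of
  -- `μ` and the last iterate; that of `Z * L` is only 48.
  have i1 : X * (1 / 2) ≤ X * L := mul_le_mul_of_nonneg_left (by linarith) hX0
  have i2 : (4 * (4 * Real.log (2 * k) + 2)) * Z ≤ (48 * L) * Z :=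
    mul_le_mul_of_nonneg_right (by linarith) hZ0
  have i3 : (10 * Real.log a) * X ≤ (10 * L) * X := mul_le_mul_of_nonneg_right (by linarith) hX0
  have i4 : 0 ≤ Z * L := mul_nonneg hZ0 (by linarith)
  rw [e1, e2, e3]
  linarith

end ConMDP

/-! ### The main theorem: choice of constants and assembly. -/

open ConMDP in
theorem mainTheorem7 :
    ∃ C cv cs cμ cT : ℝ, 0 < C ∧ 0 < cv ∧ 0 < cs ∧ 0 < cμ ∧ 0 < cT ∧
    ∀ (S : Type u) (A : S → Type v) (K : Type w)
      [Fintype S] [DecidableEq S] [Nonempty S]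
      [∀ i, Fintype (A i)] [∀ i, DecidableEq (A i)] [∀ i, Nonempty (A i)]
      [Fintype K] [DecidableEq K] [Nonempty K]
      (M : MDP S A) (d : K → Pair S A → ℝ),
      IsMixing M → (∀ k x, 0 ≤ d k x) → (∃ μ, IsApproxSolution M d 0 μ) →
      -- rounding an arbitrary approximate solution of the minimax problem
      (∀ (ε : ℝ) (v : S → ℝ) (s : K → ℝ) (μ : Pair S A → ℝ) (lam : S → ℝ)
        (π : (i : S) → A i → ℝ),
        IsApproxSaddle M d ε v s μ → IsDecomposition μ lam π →
        IsApproxPolicy M d (C * ε) π) ∧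
      -- rounding the output of stochastic mirror descent with `T = n + 1` iterates
      (∀ (ε : ℝ) (v₁ : S → ℝ) (n : ℕ) (ηv ηs ημ : ℝ), 0 < ε → ε < 1 →
        v₁ ∈ valueDomain M d →
        ηv = cv * ε →
        ηs = cs * ε / (Fintype.card K * maxEntry d ^ 2) →
        ημ = cμ * ε / ((tmix M : ℝ) ^ 2 * maxEntry d ^ 2 * Fintype.card (Pair S A)) →
        cT * (((tmix M : ℝ) ^ 2 * Fintype.card (Pair S A) + Fintype.card K) *
          maxEntry d ^ 2 / ε ^ 2 * Real.log (Fintype.card K * Fintype.card (Pair S A))) ≤ n + 1 →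
        (∀ ω : Fin n → Sample S A K, ∃! q : (S → ℝ) × ((i : S) → A i → ℝ),
          IsDecomposition (smdOutput M d ηv ηs ημ v₁ ω) q.1 q.2) ∧
        ∀ (lam : (Fin n → Sample S A K) → S → ℝ)
          (π : (Fin n → Sample S A K) → (i : S) → A i → ℝ),
          (∀ ω, IsDecomposition (smdOutput M d ηv ηs ημ v₁ ω) (lam ω) (π ω)) →
          ∃ δ : (Fin n → Sample S A K) → ℝ,
            (∀ ω, 0 ≤ δ ω ∧ IsApproxPolicy M d (δ ω) (π ω)) ∧
            ∑ ω, smdProb M d ηv ηs ημ v₁ ω * δ ω ≤ C * ε) := by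
  -- `180 = 162 + 18`: the deterministic regret from `initial_regret_le`, and the expected round
  -- cost `4ε + 16 · ε/4 + 100 · ε/10`.
  refine ⟨180, 1, 1 / 4, 1 / 10, 1, by norm_num, by norm_num, by norm_num, by norm_num,
    by norm_num, ?_⟩
  intro S A K _ _ _ _ _ _ _ _ _ M d hM hd hfeas
  have hD : 1 ≤ maxEntry d := one_le_maxEntry hfeas
  have ht : 1 ≤ tmix M := one_le_tmix hM
  refine ⟨fun ε v s μ lam π hsad hdec => ?_, ?_⟩
  · obtain ⟨hε, h⟩ := objective_ge_of_isApproxSaddle hD ht hfeas hsad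
    exact isApproxPolicy_of_objective_ge hM hdec fun v' hv' s' hs' => by
      linarith [h v' hv' s' hs']
  intro ε v₁ n ηv ηs ημ hε hε1 hv₁ hηv hηs hημ hT
  obtain ⟨μ₀, hμ₀⟩ := hfeas
  have : Nonempty (Pair S A) := ⟨⟨Classical.arbitrary S, Classical.arbitrary _⟩⟩
  have hout : ∀ ω : Fin n → Sample S A K, _ :=
    fun ω => smdOutput_pos (M := M) (d := d) (ηv := ηv) (ηs := ηs) (ημ := ημ) v₁ hv₁ ω
  refine ⟨fun ω => existsUnique_decomposition (hout ω).1 (hout ω).2, fun lam π hdec => ?_⟩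
  have ht' : (1 : ℝ) ≤ tmix M := by exact_mod_cast ht
  have hA : (1 : ℝ) ≤ Fintype.card (Pair S A) := by exact_mod_cast Fintype.card_pos
  have hK : (1 : ℝ) ≤ Fintype.card K := by exact_mod_cast Fintype.card_pos
  -- When the product is 1 its logarithm vanishes and the bound on `T` is void, so this case is
  -- separate.
  rcases Nat.lt_or_ge (Fintype.card K * Fintype.card (Pair S A)) 2 with hsmall | hbig
  · -- a single state-action pair: the output is the feasible point
    have hcard : Fintype.card (Pair S A) ≤ 1 := by
      have h1 : 0 < Fintype.card K := Fintype.card_pos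
      nlinarith
    have : Subsingleton (Pair S A) := Fintype.card_le_one_iff_subsingleton.1 hcard
    refine ⟨fun _ => 0, fun ω => ⟨le_rfl, isApproxPolicy_of_objective_ge hM (hdec ω)
      fun v _ s hs => ?_⟩, by simp only [mul_zero, Finset.sum_const_zero]; positivity⟩
    have e : smdOutput M d ηv ηs ημ v₁ ω = μ₀ := by
      funext x
      have h1 := (hout ω).1.2
      have h2 := hμ₀.1.2
      rw [Fintype.sum_subsingleton _ x] at h1 h2
      rw [h1, h2]
    rw [e, neg_zero]
    exact objective_nonneg_of_feasible hμ₀ v hs.1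
  have hbig' : (2 : ℝ) ≤ Fintype.card K * Fintype.card (Pair S A) := by exact_mod_cast hbig
  have hreg := initial_regret_le hA hK hbig' hD ht' hε hε1 hT
  rw [← hηv, ← hηs, ← hημ] at hreg
  have hηv0 : 0 < ηv := by rw [hηv]; linarith
  have hηs0 : 0 < ηs := by rw [hηs]; positivity
  have hημ0 : 0 < ημ := by rw [hημ]; positivity
  have eηs : ηs * (Fintype.card K * maxEntry d ^ 2) = ε / 4 := by
    rw [hηs]
    field_simp
  have eημ : ημ * (Fintype.card (Pair S A) * (maxEntry d * tmix M) ^ 2) = ε / 10 := by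
    rw [hημ]
    field_simp
  have hηs1 : ηs * (2 * (Fintype.card K * maxEntry d)) ≤ 1 := by
    have h1 : ηs * (Fintype.card K * maxEntry d) ≤ ηs * (Fintype.card K * maxEntry d ^ 2) :=
      mul_le_mul_of_nonneg_left (mul_le_mul_of_nonneg_left (by nlinarith) (by linarith)) hηs0.le
    linarith
  have hημ1 : ημ * (Fintype.card (Pair S A) * (10 * (maxEntry d * tmix M))) ≤ 1 := by
    have hDt : 1 ≤ maxEntry d * tmix M := one_le_mul_of_one_le_of_one_le hD ht'
    have h1 : ημ * (Fintype.card (Pair S A) * (maxEntry d * tmix M))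
        ≤ ημ * (Fintype.card (Pair S A) * (maxEntry d * tmix M) ^ 2) :=
      mul_le_mul_of_nonneg_left (mul_le_mul_of_nonneg_left (by nlinarith) (by linarith)) hημ0.le
    linarith
  set B := 64 * (Fintype.card (Pair S A) * (maxEntry d * tmix M) ^ 2) / ηv
    + (4 * Real.log (2 * Fintype.card K) + 2) / ηs
    + Real.log (Fintype.card (Pair S A)) / ημ + 12 * (maxEntry d * tmix M) with hB
  have hpath := fun (ω : Fin n → Sample S A K) v (hv : v ∈ valueDomain M d) s
      (hs : s ∈ multiplierDomain K) =>
    neg_objective_smdOutput_le hd hD ht hηv0 hηs0 hημ0 hηs1 hημ1 hμ₀ hv₁ hv hs ω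
  rw [← hB] at hpath
  -- The pathwise bound contains no `(v, s)`, so it can itself serve as `δ`.
  refine ⟨fun ω => (B + ∑ t : Fin n, roundCost M d ηv ηs ημ μ₀
    (trajectory (trackedStep M d ηv ηs ημ) (trackedInit v₁) ω t) (ω t)) / (n + 1),
    fun ω => ⟨?_, isApproxPolicy_of_objective_ge hM (hdec ω) fun v hv s hs => ?_⟩, ?_⟩
  -- The objective vanishes at `v = 0`, `s = 0`, so the pathwise bound there gives `δ ≥ 0`.
  · have h0 := hpath ω 0 (fun i => by simpa using valueDomain_radius_nonneg M d) 0
      ⟨fun _ => le_rfl, by simp⟩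
    simpa [objective] using h0
  · linarith [hpath ω v hv s hs]
  · obtain ⟨hone, hcost⟩ := expected_cost_le (step := trackedStep M d ηv ηs ημ)
      (prob := fun w => sampleProb M w.z) (Inv := TrackedRegular M d)
      (fun w hw ξ => hw.trackedStep ξ) (fun w hw => hw.reg.sampleProb_nonneg)
      (fun w hw => hw.reg.sum_sampleProb)
      (fun w hw => expected_roundCost_le hD ht hηv0 hηs0 hημ0 μ₀ hw) n (trackedInit v₁)
      (trackedInit_regular hv₁)
    simp only [trajectory_z] at hone hcost
    have hn : (0 : ℝ) < n + 1 := by positivity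
    simp only [← mul_div_assoc]
    rw [← Finset.sum_div, div_le_iff₀ hn]
    simp only [mul_add (∏ _, _), smdProb, Finset.sum_add_distrib]
    rw [← Finset.sum_mul]
    rw [hone, one_mul]
    have e : (n : ℝ) * (4 * ηv + 16 * (ηs * (Fintype.card K * maxEntry d ^ 2))
        + 100 * (ημ * (Fintype.card (Pair S A) * (maxEntry d * tmix M) ^ 2))) = 18 * ε * n := by
      rw [eηs, eημ, hηv]
      ring
    rw [e] at hcost
    linarith
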